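/- **Theorem.** Let $n\ge 1$, $\rho>1$, $0<s<1$ and $0<d\le n$. Let $\Pi=([0,2\pi]^{\mathbb N_0})^n$ carry the product of the uniform (normalized Lebesgue) probability measures on $[0,2\pi]$, and for $\theta=(\theta_{ij})_{1\le i\le n,\ j\ge 0}\in\Pi$ let $$W_{s,\theta}(x)=\sum_{i=1}^{n}\sum_{j=0}^{\infty}\rho^{-js}\cos(\rho^{j}x_i+\theta_{ij}),\qquad x=(x_1,\dots,x_n)\in\mathbb R^n .$$ Let $K\subset\mathbb R^n$ be a $d$-set, that is, a compact set which is the support of a Borel measure $\mu$ on $\mathbb R^n$ with $0<\mu(\mathbb R^n)<\infty$ for which there are constants $c_1,c_2>0$ such that $c_1r^d\le\mu(B_r(x))\le c_2r^d$ for all $r\in(0,1]$ and all $x\in K$, where $B_r(x)$ is the closed Euclidean ball with center $x$ and radius $r$. Then, for almost every $\theta\in\Pi$, the graph $\Gamma(W_{s,\theta}|_K)=\{(x,W_{s,\theta}(x)):x\in K\}\subset\mathbb R^{n+1}$ has Hausdorff dimension $$\dim_H\Gamma(W_{s,\theta}|_K)=H(d,s),\qquad H(d,s):=\begin{cases} d+1-s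 & \text{if } s<d,\\ d/s & \text{if } s\ge d.\end{cases}$$ -/

import Mathlib

open MeasureTheory

namespace WeierstrassGraph

/-- A `d`-set in `ℝⁿ`: a compact set `K` which is the support of a mass distribution `μ`
(a Borel measure with `0 < μ(ℝⁿ) < ∞`) for which the measure of the closed ball of radius `r`
about a point of `K` is comparable to `r ^ d`, uniformly in `r ∈ (0, 1]` and in the point. -/
def IsDSet {n : ℕ} (d : ℝ) (K : Set (EuclideanSpace ℝ (Fin n))) : Prop :=
  IsCompact K ∧
    ∃ μ : Measure (EuclideanSpace ℝ (Fin n)),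
      0 < μ Set.univ ∧ μ Set.univ < ⊤ ∧ μ.support = K ∧
        ∃ c₁ c₂ : ℝ, 0 < c₁ ∧ 0 < c₂ ∧ ∀ r : ℝ, 0 < r → r ≤ 1 → ∀ x ∈ K,
          ENNReal.ofReal (c₁ * r ^ d) ≤ μ (Metric.closedBall x r) ∧
            μ (Metric.closedBall x r) ≤ ENNReal.ofReal (c₂ * r ^ d)

/-- The exponent `H(d, s)`. -/
noncomputable def dimExponent (d s : ℝ) : ℝ :=
  if s < d then d + 1 - s else d / s

/-- The interval `[0, 2π]`. -/
abbrev PhaseInterval : Type := Set.Icc (0 : ℝ) (2 * Real.pi)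

/-- The uniform probability measure on `[0, 2π]`: normalized Lebesgue measure. -/
noncomputable def uniformPhase : Measure PhaseInterval :=
  (ENNReal.ofReal (2 * Real.pi))⁻¹ • Measure.comap Subtype.val (volume : Measure ℝ)

instance : IsProbabilityMeasure uniformPhase := by
  refine ⟨?_⟩
  have hpos : (0 : ℝ) < 2 * Real.pi := Real.two_pi_pos
  have hvol : (Measure.comap Subtype.val (volume : Measure ℝ) : Measure PhaseInterval) Set.univ =
      ENNReal.ofReal (2 * Real.pi) := by
    rw [comap_subtype_coe_apply measurableSet_Icc, Set.image_univ, Subtype.range_coe,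
      Real.volume_Icc, sub_zero]
  rw [uniformPhase, Measure.smul_apply, hvol, smul_eq_mul]
  exact ENNReal.inv_mul_cancel (by simpa using hpos) ENNReal.ofReal_ne_top

/-- The phase space `([0, 2π]^ℕ)ⁿ`; the phase `θ i j` belongs to the coordinate `i` and the
frequency `ρ ^ j`. -/
abbrev PhaseSpace (n : ℕ) : Type := Fin n → ℕ → PhaseInterval

/-- The product probability measure on the phase space. -/
noncomputable def phaseMeasure (n : ℕ) : Measure (PhaseSpace n) :=
  Measure.pi fun _ : Fin n => Measure.infinitePi fun _ : ℕ => uniformPhase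

instance (n : ℕ) : IsProbabilityMeasure (phaseMeasure n) := by
  unfold phaseMeasure
  infer_instance

/-- The `n`-dimensional Weierstrass function with phases `θ`. -/
noncomputable def weierstrass {n : ℕ} (ρ s : ℝ) (θ : PhaseSpace n)
    (x : EuclideanSpace ℝ (Fin n)) : ℝ :=
  ∑ i : Fin n, ∑' j : ℕ, ρ ^ (-(j : ℝ) * s) * Real.cos (ρ ^ j * x i + (θ i j : ℝ))

/-- The series defining the Weierstrass function converge absolutely, for all phases. -/
theorem summable_weierstrass {n : ℕ} {ρ s : ℝ} (hρ : 1 < ρ) (hs : 0 < s) (θ : PhaseSpace n)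
    (x : EuclideanSpace ℝ (Fin n)) (i : Fin n) :
    Summable fun j : ℕ => ρ ^ (-(j : ℝ) * s) * Real.cos (ρ ^ j * x i + (θ i j : ℝ)) := by
  have h0 : (0 : ℝ) < ρ := by linarith
  have hg : Summable fun j : ℕ => (ρ ^ (-s)) ^ j :=
    summable_geometric_of_lt_one (Real.rpow_nonneg h0.le _)
      (Real.rpow_lt_one_of_one_lt_of_neg hρ (by linarith))
  refine Summable.of_norm_bounded hg fun j => ?_
  have he : ρ ^ (-(j : ℝ) * s) = (ρ ^ (-s)) ^ j := by
    rw [← Real.rpow_natCast, ← Real.rpow_mul h0.le]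
    congr 1
    ring
  rw [norm_mul, he, Real.norm_of_nonneg (by positivity), Real.norm_eq_abs]
  exact mul_le_of_le_one_right (by positivity) (Real.abs_cos_le_one _)

/-- The graph of the restriction of `f` to `K`, as a subset of the Euclidean space `ℝⁿ⁺¹`. -/
def graphOn {n : ℕ} (f : EuclideanSpace ℝ (Fin n) → ℝ) (K : Set (EuclideanSpace ℝ (Fin n))) :
    Set (EuclideanSpace ℝ (Fin (n + 1))) :=
  (fun x => WithLp.toLp 2 (Fin.snoc (α := fun _ => ℝ) (fun i => x i) (f x))) '' K

end WeierstrassGraph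

/-! Upper bound, for every `θ`: `W` is `t`-Hölder for each `t < s`, and `K` is covered by about
`r^(-d)` balls of radius `r`. Cutting the graph over each ball into about `r^(t-1)` layers of height
`r` gives dimension at most `d + 1 - t`; using base balls of radius `r^(1/t)` instead gives `d / t`.
Then `t` tends to `s`.

Lower bound, for almost every `θ`: as a function of one phase `θ i j`, the increment `W(x) - W(y)`
is a sinusoid plus a constant, with amplitude `2 ρ^(-js) |sin(ρ^j (x_i - y_i)/2)|`. For a coordinate
`i` carrying a fixed proportion of `|x - y|` and for `m` consecutive `j` with `ρ^j` comparable to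
`1/|x_i - y_i|`, this amplitude is at least a constant times `|x - y|^s`. A single sinusoid
concentrates near its extrema, but `m` independent phases are rarely all near an extremum, and away
from the extrema one phase has bounded density. Hence `P(|W(x) - W(y)| ≤ r) ≤ C (r/|x - y|^s)^β` for
any `β < 1` (`phaseMeasure_weierstrass_sub_le`).

If also `sβ < d`, integrating this over pairs with `|x - y| ≤ r` bounds the expected `μ × μ` measure
of pairs with `r`-close images by a multiple of `r^(d + (1-s)β)`
(`lintegral_measure_closePairs_le`). Summation over dyadic scales and the mass distribution
principle give dimension at least every `t < d + (1-s)β`. The supremum of this exponent over `β <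
min(1, d/s)` is `H(d, s)`. -/

namespace WeierstrassGraph

/-! ### Small-value estimates for one phase -/

/-- Two points of a short interval at which the cosine has the same sign and is bounded away from
zero are separated by the sine. -/
theorem abs_sub_le_of_cos_same_sign {u v η : ℝ} (h : |u - v| ≤ 1)
    (hc : η ≤ |(Real.cos u + Real.cos v) / 2|) :
    2 / Real.pi * η * |u - v| ≤ |Real.sin u - Real.sin v| := by
  have hpi := Real.pi_pos
  have hpi3 := Real.pi_gt_three
  rw [Real.sin_sub_sin, abs_mul, abs_mul, abs_two]
  -- The mean of the two cosines is the cosine of the midpoint times `cos((u - v)/2)`, so its lower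
  -- bound passes to the midpoint cosine.
  have hmid : η ≤ |Real.cos ((u + v) / 2)| := by
    refine hc.trans ?_
    rw [Real.cos_add_cos]
    have : 2 * Real.cos ((u + v) / 2) * Real.cos ((u - v) / 2) / 2 =
      Real.cos ((u + v) / 2) * Real.cos ((u - v) / 2) := by ring
    rw [this, abs_mul]
    exact mul_le_of_le_one_right (abs_nonneg _) (Real.abs_cos_le_one _)
  have hsin : 2 / Real.pi * (|u - v| / 2) ≤ |Real.sin ((u - v) / 2)| := by
    have h1 := Real.mul_abs_le_abs_sin (x := (u - v) / 2) (by
      rw [abs_div, abs_two]; linarith)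
    rwa [abs_div, abs_two] at h1
  have h0 : 0 ≤ 2 / Real.pi * (|u - v| / 2) := by positivity
  calc 2 / Real.pi * η * |u - v| = 2 * (2 / Real.pi * (|u - v| / 2)) * η := by ring
    _ ≤ 2 * (2 / Real.pi * (|u - v| / 2)) * |Real.cos ((u + v) / 2)| := by gcongr
    _ ≤ _ := by gcongr

theorem volume_sin_near_le (α a : ℝ) {q η r : ℝ} (hq : q ≠ 0) (hη : 0 < η) :
    volume {u : ℝ | u ∈ Set.Icc 0 (2 * Real.pi) ∧ η ≤ |Real.cos (α + u)| ∧
      |q * Real.sin (α + u) - a| ≤ r} ≤ ENNReal.ofReal (14 * Real.pi * (r / (|q| * η))) := by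
  have hpi := Real.pi_pos
  have hq' : 0 < |q| := abs_pos.2 hq
  -- Seven unit intervals cover `[0, 2π]`, and the Boolean records the sign of the cosine. On each
  -- of the 14 pieces the sine separates points, which bounds the diameter.
  set S : Fin 7 × Bool → Set ℝ := fun p => {u : ℝ | u ∈ Set.Icc (p.1 : ℝ) (p.1 + 1) ∧
    (if p.2 then η ≤ Real.cos (α + u) else Real.cos (α + u) ≤ -η) ∧
      |q * Real.sin (α + u) - a| ≤ r} with hS
  have hdiam : ∀ p, volume (S p) ≤ ENNReal.ofReal (Real.pi * (r / (|q| * η))) := by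
    intro p
    refine (Real.volume_le_diam _).trans (Metric.ediam_le fun u hu v hv => ?_)
    rw [edist_dist]
    refine ENNReal.ofReal_le_ofReal ?_
    rw [Real.dist_eq]
    obtain ⟨hu1, hu2, hu3⟩ := hu
    obtain ⟨hv1, hv2, hv3⟩ := hv
    have huv : |(α + u) - (α + v)| ≤ 1 := by
      rw [abs_le]; constructor <;> linarith [hu1.1, hu1.2, hv1.1, hv1.2]
    have hcos : η ≤ |(Real.cos (α + u) + Real.cos (α + v)) / 2| := by
      rcases p with ⟨k, _ | _⟩
      · simp only [Bool.false_eq_true, if_false] at hu2 hv2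
        rw [le_abs]; right; linarith
      · simp only [if_true] at hu2 hv2
        rw [le_abs]; left; linarith
    have h1 := abs_sub_le_of_cos_same_sign huv hcos
    have h2 : |q| * |Real.sin (α + u) - Real.sin (α + v)| ≤ 2 * r := by
      rw [← abs_mul]
      rw [abs_le] at hu3 hv3 ⊢
      constructor <;> linarith [hu3.1, hu3.2, hv3.1, hv3.2]
    have h3 : (α + u) - (α + v) = u - v := by ring
    rw [h3] at h1
    have h4 : |q| * (2 / Real.pi * η * |u - v|) ≤ 2 * r :=
      (mul_le_mul_of_nonneg_left h1 hq'.le).trans h2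
    rw [← mul_div_assoc, le_div_iff₀ (by positivity)]
    have h5 : |q| * (2 / Real.pi * η * |u - v|) = 2 / Real.pi * (|u - v| * (|q| * η)) := by ring
    rw [h5, div_mul_eq_mul_div, div_le_iff₀ hpi] at h4
    linarith
  have hcover : {u : ℝ | u ∈ Set.Icc 0 (2 * Real.pi) ∧ η ≤ |Real.cos (α + u)| ∧
      |q * Real.sin (α + u) - a| ≤ r} ⊆ ⋃ p, S p := by
    rintro u ⟨⟨hu0, hu1⟩, hu2, hu3⟩
    have hlt : u < 7 := by linarith [Real.pi_lt_d2]
    have hfl : ⌊u⌋₊ < 7 := (Nat.floor_lt hu0).2 (by exact_mod_cast hlt)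
    refine Set.mem_iUnion.2 ?_
    have hmem : u ∈ Set.Icc (((⟨⌊u⌋₊, hfl⟩ : Fin 7) : ℕ) : ℝ) (((⟨⌊u⌋₊, hfl⟩ : Fin 7) : ℕ) + 1) :=
      ⟨Nat.floor_le hu0, (Nat.lt_floor_add_one u).le⟩
    rcases le_abs.1 hu2 with h | h
    · exact ⟨(⟨⌊u⌋₊, hfl⟩, true), hmem, by simpa using h, hu3⟩
    · refine ⟨(⟨⌊u⌋₊, hfl⟩, false), hmem, ?_, hu3⟩
      simp only [Bool.false_eq_true, if_false]; linarith
  calc _ ≤ volume (⋃ p, S p) := measure_mono hcover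
    _ ≤ ∑ p, volume (S p) := measure_iUnion_fintype_le _ _
    _ ≤ ∑ _p : Fin 7 × Bool, ENNReal.ofReal (Real.pi * (r / (|q| * η))) :=
        Finset.sum_le_sum fun p _ => hdiam p
    _ = _ := by
        rw [Finset.sum_const, nsmul_eq_mul, ← ENNReal.ofReal_natCast,
          ← ENNReal.ofReal_mul (by positivity)]
        congr 1
        simp
        ring

theorem uniformPhase_le_volume (S : Set PhaseInterval) :
    uniformPhase S ≤ volume (Subtype.val '' S) := by
  rw [uniformPhase, Measure.smul_apply, smul_eq_mul, comap_subtype_coe_apply measurableSet_Icc]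
  refine mul_le_of_le_one_left (by positivity) ?_
  rw [ENNReal.inv_le_one, ENNReal.one_le_ofReal]
  linarith [Real.pi_gt_three]

theorem uniformPhase_sin_near_le (α a : ℝ) {q η r : ℝ} (hq : q ≠ 0) (hη : 0 < η) :
    uniformPhase {u | η ≤ |Real.cos (α + u)| ∧ |q * Real.sin (α + u) - a| ≤ r} ≤
      ENNReal.ofReal (14 * Real.pi * (r / (|q| * η))) := by
  refine (uniformPhase_le_volume _).trans
    ((measure_mono ?_).trans (volume_sin_near_le α a hq hη))
  rintro _ ⟨u, hu, rfl⟩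
  exact ⟨u.2, hu⟩

/-- A shift by `π/2` exchanges sine and cosine. Where the cosine is below `η ≤ 1/2` the sine exceeds
`1/2`, so the previous estimate applies with threshold `1/2`; for larger `η` the bound exceeds 1. -/
theorem uniformPhase_cos_small_le (α : ℝ) {η : ℝ} (hη : 0 < η) :
    uniformPhase {u | |Real.cos (α + u)| < η} ≤ ENNReal.ofReal (28 * Real.pi * η) := by
  have hpi3 := Real.pi_gt_three
  rcases le_or_gt η (1 / 2) with h | h
  · have := uniformPhase_sin_near_le (α + Real.pi / 2) 0 (r := η) one_ne_zero
      (by norm_num : (0 : ℝ) < 1 / 2)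
    refine (measure_mono fun u hu => ?_).trans (this.trans (ENNReal.ofReal_le_ofReal ?_))
    · have e : α + Real.pi / 2 + u = (α + u) + Real.pi / 2 := by ring
      simp only [Set.mem_ofPred_eq] at hu ⊢
      rw [e, Real.cos_add_pi_div_two, Real.sin_add_pi_div_two, abs_neg, one_mul, sub_zero]
      refine ⟨?_, hu.le⟩
      by_contra! hlt
      have h1 := Real.sin_sq_add_cos_sq (α + (u : ℝ))
      rw [← sq_abs (Real.sin _), ← sq_abs (Real.cos _)] at h1
      nlinarith [abs_nonneg (Real.sin (α + (u : ℝ))), abs_nonneg (Real.cos (α + (u : ℝ)))]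
    · rw [abs_one]
      apply le_of_eq
      ring
  · refine prob_le_one.trans ?_
    rw [ENNReal.one_le_ofReal]
    nlinarith

/-! ### Resampling one phase -/

/-- Resampling one coordinate preserves a product of probability measures. -/
theorem measurePreserving_update_infinitePi {ι : Type*} [DecidableEq ι] {X : ι → Type*}
    [∀ i, MeasurableSpace (X i)] (μ : ∀ i, Measure (X i)) [∀ i, IsProbabilityMeasure (μ i)]
    (i : ι) :
    MeasurePreserving (fun p : (∀ i, X i) × X i => Function.update p.1 i p.2)
      ((Measure.infinitePi μ).prod (μ i)) (Measure.infinitePi μ) := by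
  have hm : Measurable fun p : (∀ i, X i) × X i => Function.update p.1 i p.2 := by
    refine measurable_pi_iff.2 fun k => ?_
    by_cases h : k = i
    · subst h
      simpa using measurable_snd
    · simp only [ne_eq, h, not_false_eq_true, Function.update_of_ne]
      exact (measurable_pi_apply k).comp measurable_fst
  refine ⟨hm, Measure.eq_infinitePi _ fun s t ht => ?_⟩
  rw [Measure.map_apply hm (MeasurableSet.pi s.countable_toSet fun k _ => ht k)]
  have hpre : (fun p : (∀ i, X i) × X i => Function.update p.1 i p.2) ⁻¹' (Set.pi s t) =
      (Set.pi (s.erase i : Finset ι) t) ×ˢ (if i ∈ s then t i else Set.univ) := by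
    ext p
    simp only [Set.mem_preimage, Set.mem_pi, Finset.mem_coe, Set.mem_prod, Finset.mem_erase]
    constructor
    · intro h
      refine ⟨fun k hk => by simpa [hk.1] using h k hk.2, ?_⟩
      split_ifs with his
      · simpa using h i his
      · trivial
    · rintro ⟨h1, h2⟩ k hk
      by_cases hki : k = i
      · subst hki
        rw [if_pos hk] at h2
        simpa using h2
      · simpa [hki] using h1 k ⟨hki, hk⟩
  rw [hpre, Measure.prod_prod, Measure.infinitePi_pi _ fun k _ => ht k]
  split_ifs with his
  · exact Finset.prod_erase_mul s (fun k => μ k (t k)) his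
  · rw [Finset.erase_eq_of_notMem his, measure_univ, mul_one]

/-- The phases with the phase of index `(i, j)` replaced by `u`. -/
def resample {n : ℕ} (i : Fin n) (j : ℕ) (θ : PhaseSpace n) (u : PhaseInterval) : PhaseSpace n :=
  Function.update θ i (Function.update (θ i) j u)

/-- For a fixed new phase `u`, the preimage of a box is again a box, altered only in its side `i`.
Integration over `u` then reduces the claim to resampling inside the infinite product of row `i`. -/
theorem measurePreserving_resample {n : ℕ} (i : Fin n) (j : ℕ) :
    MeasurePreserving (fun p : PhaseSpace n × PhaseInterval => resample i j p.1 p.2)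
      ((phaseMeasure n).prod uniformPhase) (phaseMeasure n) := by
  have hinner := measurePreserving_update_infinitePi (fun _ : ℕ => uniformPhase) j
  set ν := Measure.infinitePi fun _ : ℕ => uniformPhase with hν
  have hm : Measurable (fun p : PhaseSpace n × PhaseInterval => resample i j p.1 p.2) := by
    have h0 : Measurable fun p : PhaseSpace n × PhaseInterval => (p.1 i, p.2) :=
      ((measurable_pi_apply i).comp measurable_fst).prodMk measurable_snd
    have h1 : Measurable fun p : PhaseSpace n × PhaseInterval =>
        Function.update (p.1 i) j p.2 := hinner.measurable.comp h0
    refine measurable_pi_iff.2 fun k => ?_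
    by_cases h : k = i
    · subst h
      simpa [resample] using h1
    · simp only [resample, ne_eq, h, not_false_eq_true, Function.update_of_ne]
      exact (measurable_pi_apply k).comp measurable_fst
  refine ⟨hm, (Measure.pi_eq fun t ht => ?_).symm⟩
  have hbox := MeasurableSet.univ_pi ht
  rw [Measure.map_apply hm hbox, Measure.prod_apply_symm (hm hbox)]
  have hsec : ∀ u : PhaseInterval, phaseMeasure n ((fun θ => (θ, u)) ⁻¹'
      ((fun p : PhaseSpace n × PhaseInterval => resample i j p.1 p.2) ⁻¹' Set.univ.pi t)) =
      ν {ω | Function.update ω j u ∈ t i} * ∏ k ∈ Finset.univ.erase i, ν (t k) := by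
    intro u
    have hset : ((fun θ => (θ, u)) ⁻¹'
        ((fun p : PhaseSpace n × PhaseInterval => resample i j p.1 p.2) ⁻¹' Set.univ.pi t)) =
        Set.univ.pi (Function.update t i {ω | Function.update ω j u ∈ t i}) := by
      ext θ
      simp only [Set.mem_preimage, Set.mem_pi, Set.mem_univ, true_implies]
      refine forall_congr' fun k => ?_
      by_cases h : k = i
      · subst h
        simp [resample]
      · simp [resample, h]
    rw [hset, phaseMeasure, Measure.pi_pi, ← Finset.mul_prod_erase _ _ (Finset.mem_univ i)]
    congr 1
    · simp [hν]
    · refine Finset.prod_congr rfl fun k hk => ?_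
      rw [Function.update_of_ne (Finset.ne_of_mem_erase hk)]
  simp_rw [hsec]
  have hmeas : Measurable fun u : PhaseInterval => ν {ω | Function.update ω j u ∈ t i} :=
    measurable_measure_prodMk_right (hinner.measurable (ht i))
  rw [lintegral_mul_const _ hmeas, ← Finset.mul_prod_erase _ _ (Finset.mem_univ i)]
  congr 1
  rw [← hinner.measure_preimage (ht i).nullMeasurableSet,
    Measure.prod_apply_symm (hinner.measurable (ht i))]
  rfl

/-- A set has small measure if its sections along one phase are uniformly small. -/
theorem phaseMeasure_le_of_resample {n : ℕ} (i : Fin n) (j : ℕ) {E : Set (PhaseSpace n)}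
    (hE : MeasurableSet E) {b : ENNReal}
    (h : ∀ θ, uniformPhase {u | resample i j θ u ∈ E} ≤ b) : phaseMeasure n E ≤ b := by
  have hp := measurePreserving_resample i j
  rw [← hp.measure_preimage hE.nullMeasurableSet, Measure.prod_apply (hp.measurable hE)]
  calc _ ≤ ∫⁻ _θ, b ∂(phaseMeasure n) := lintegral_mono fun θ => h θ
    _ = b := by simp

/-! ### Anticoncentration from several independent phases -/

theorem phaseMeasure_cos_small_le {n : ℕ} (i : Fin n) (T : Finset ℕ) (α : ℕ → ℝ) {η : ℝ}
    (hη : 0 < η) :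
    phaseMeasure n {θ | ∀ j ∈ T, |Real.cos (α j + θ i j)| < η} ≤
      ENNReal.ofReal (28 * Real.pi * η) ^ T.card := by
  have hev : MeasurePreserving (Function.eval i) (phaseMeasure n)
      (Measure.infinitePi fun _ : ℕ => uniformPhase) :=
    measurePreserving_eval (fun _ : Fin n => Measure.infinitePi fun _ : ℕ => uniformPhase) i
  have ht : ∀ j, MeasurableSet {u : PhaseInterval | |Real.cos (α j + u)| < η} := fun j =>
    (isOpen_lt (by fun_prop) continuous_const).measurableSet
  have hset : {θ : PhaseSpace n | ∀ j ∈ T, |Real.cos (α j + θ i j)| < η} =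
      Function.eval i ⁻¹' (Set.pi T fun j => {u : PhaseInterval | |Real.cos (α j + u)| < η}) := by
    ext θ
    simp
  rw [hset, hev.measure_preimage
    (MeasurableSet.pi T.countable_toSet fun j _ => ht j).nullMeasurableSet,
    Measure.infinitePi_pi _ fun j _ => ht j]
  exact Finset.prod_le_pow_card _ _ _ fun j _ => uniformPhase_cos_small_le (α j) hη

/-- Anticoncentration for a random variable which is a sinusoid of amplitude at least `q₀` in each
of finitely many phases. -/
theorem phaseMeasure_abs_le_of_sinusoidal {n : ℕ} (i : Fin n) (T : Finset ℕ)
    {g : PhaseSpace n → ℝ} (hg : Measurable g) {q₀ η r : ℝ} (hq₀ : 0 < q₀) (hη : 0 < η)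
    (hr : 0 ≤ r) (α q : ℕ → ℝ) (hq : ∀ j ∈ T, q₀ ≤ |q j|)
    (h : ∀ j ∈ T, ∀ θ, ∃ a, ∀ u, g (resample i j θ u) = q j * Real.sin (α j + u) - a) :
    phaseMeasure n {θ | |g θ| ≤ r} ≤
      ENNReal.ofReal ((28 * Real.pi * η) ^ T.card + T.card * (14 * Real.pi * (r / (q₀ * η)))) := by
  have hpi := Real.pi_pos
  -- On `B` all the phases in `T` are near an extremum of their sinusoids. Off `B` some phase is
  -- not, and resampling that phase alone controls `E j`.
  set B : Set (PhaseSpace n) := {θ | ∀ j ∈ T, |Real.cos (α j + θ i j)| < η}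
  set E : ℕ → Set (PhaseSpace n) := fun j => {θ | η ≤ |Real.cos (α j + θ i j)| ∧ |g θ| ≤ r}
  have hsub : {θ | |g θ| ≤ r} ⊆ B ∪ ⋃ j ∈ T, E j := by
    intro θ hθ
    by_cases hB : θ ∈ B
    · exact Or.inl hB
    · right
      simp only [B, Set.mem_ofPred_eq, not_forall, not_lt] at hB
      obtain ⟨j, hj, hj'⟩ := hB
      exact Set.mem_biUnion hj ⟨hj', hθ⟩
  have hE : ∀ j ∈ T, phaseMeasure n (E j) ≤ ENNReal.ofReal (14 * Real.pi * (r / (q₀ * η))) := by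
    intro j hj
    have hqj := hq j hj
    have hqj0 : 0 < |q j| := hq₀.trans_le hqj
    refine phaseMeasure_le_of_resample i j ?_ fun θ => ?_
    · have h1 : Measurable fun θ : PhaseSpace n => |Real.cos (α j + θ i j)| := by fun_prop
      exact (measurableSet_le measurable_const h1).inter
        (measurableSet_le hg.abs measurable_const)
    · obtain ⟨a, ha⟩ := h j hj θ
      refine (measure_mono fun u hu => ?_).trans ((uniformPhase_sin_near_le (α j) a (r := r)
        (abs_pos.1 hqj0) hη).trans (ENNReal.ofReal_le_ofReal ?_))
      · obtain ⟨hu1, hu2⟩ := hu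
        rw [ha u] at hu2
        refine ⟨?_, hu2⟩
        simpa [resample] using hu1
      · gcongr
  calc phaseMeasure n {θ | |g θ| ≤ r} ≤ phaseMeasure n B + ∑ j ∈ T, phaseMeasure n (E j) :=
        (measure_mono hsub).trans ((measure_union_le _ _).trans
          (add_le_add_right (measure_biUnion_finset_le _ _) _))
    _ ≤ ENNReal.ofReal (28 * Real.pi * η) ^ T.card +
        ∑ _j ∈ T, ENNReal.ofReal (14 * Real.pi * (r / (q₀ * η))) :=
        add_le_add (phaseMeasure_cos_small_le i T α hη) (Finset.sum_le_sum hE)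
    _ = _ := by
        rw [ENNReal.ofReal_add (by positivity) (by positivity), ENNReal.ofReal_pow (by positivity),
          ENNReal.ofReal_mul (p := (T.card : ℝ)) (by positivity), ENNReal.ofReal_natCast, Finset.sum_const,
          nsmul_eq_mul]

/-! ### Continuity and Hölder regularity -/

theorem rpow_neg_natCast_mul {ρ : ℝ} (hρ : 0 < ρ) (s : ℝ) (j : ℕ) :
    ρ ^ (-(j : ℝ) * s) = (ρ ^ (-s)) ^ j := by
  rw [← Real.rpow_natCast, ← Real.rpow_mul hρ.le]
  congr 1
  ring

theorem summable_rpow_neg_natCast_mul {ρ s : ℝ} (hρ : 1 < ρ) (hs : 0 < s) :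
    Summable fun j : ℕ => ρ ^ (-(j : ℝ) * s) := by
  have h0 : (0 : ℝ) < ρ := by linarith
  simp_rw [rpow_neg_natCast_mul h0]
  exact summable_geometric_of_lt_one (Real.rpow_nonneg h0.le _)
    (Real.rpow_lt_one_of_one_lt_of_neg hρ (by linarith))

theorem continuous_weierstrass {n : ℕ} {ρ s : ℝ} (hρ : 1 < ρ) (hs : 0 < s) :
    Continuous fun p : PhaseSpace n × EuclideanSpace ℝ (Fin n) => weierstrass ρ s p.1 p.2 := by
  unfold weierstrass
  refine continuous_finsetSum _ fun i _ =>
    continuous_tsum (fun j => ?_) (summable_rpow_neg_natCast_mul hρ hs) fun j p => ?_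
  · fun_prop
  · have h0 : (0 : ℝ) < ρ := by linarith
    rw [norm_mul, Real.norm_of_nonneg (by positivity), Real.norm_eq_abs]
    exact mul_le_of_le_one_right (by positivity) (Real.abs_cos_le_one _)

theorem continuous_weierstrass_phase {n : ℕ} {ρ s : ℝ} (hρ : 1 < ρ) (hs : 0 < s)
    (x : EuclideanSpace ℝ (Fin n)) : Continuous fun θ : PhaseSpace n => weierstrass ρ s θ x := by
  exact (continuous_weierstrass (n := n) hρ hs).uncurry_right x

/-- Interpolation between the Lipschitz bound for `|a - b| ≤ 1` and the trivial bound 2 beyond. -/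
theorem abs_cos_sub_cos_le_rpow (a b : ℝ) {t : ℝ} (ht₀ : 0 ≤ t) (ht₁ : t ≤ 1) :
    |Real.cos a - Real.cos b| ≤ 2 * |a - b| ^ t := by
  rcases le_or_gt |a - b| 1 with h | h
  · calc |Real.cos a - Real.cos b| ≤ |a - b| := by
          simpa [Real.dist_eq] using Real.lipschitzWith_cos.dist_le_mul a b
      _ ≤ |a - b| ^ t := by
          simpa using Real.rpow_le_rpow_of_exponent_ge' (abs_nonneg _) h ht₀ ht₁
      _ ≤ _ := by linarith [Real.rpow_nonneg (abs_nonneg (a - b)) t]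
  · have h1 : 1 ≤ |a - b| ^ t := Real.one_le_rpow h.le ht₀
    have h2 : |Real.cos a - Real.cos b| ≤ 2 := by
      rw [abs_le]
      constructor <;> linarith [Real.neg_one_le_cos a, Real.cos_le_one a, Real.neg_one_le_cos b,
        Real.cos_le_one b]
    linarith

/-- Frequency `ρ^j` contributes at most `2 ρ^(-j(s-t)) |x - y|^t` per coordinate, and these sum
geometrically because `t < s`. -/
theorem weierstrass_sub_le {n : ℕ} {ρ s t : ℝ} (hρ : 1 < ρ) (ht : 0 < t) (hts : t < s)
    (ht₁ : t ≤ 1) :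
    ∃ C : ℝ, 0 < C ∧ ∀ (θ : PhaseSpace n) (x y : EuclideanSpace ℝ (Fin n)),
      |weierstrass ρ s θ x - weierstrass ρ s θ y| ≤ C * dist x y ^ t := by
  have h0 : (0 : ℝ) < ρ := by linarith
  have hsum := summable_rpow_neg_natCast_mul hρ (sub_pos.2 hts)
  -- The `+ 1` keeps the constant positive when `n = 0`.
  refine ⟨n * (2 * ∑' j : ℕ, ρ ^ (-(j : ℝ) * (s - t))) + 1, by positivity, fun θ x y => ?_⟩
  have hterm : ∀ i : Fin n, |∑' j : ℕ, ρ ^ (-(j : ℝ) * s) * Real.cos (ρ ^ j * x i + (θ i j : ℝ)) -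
      ∑' j : ℕ, ρ ^ (-(j : ℝ) * s) * Real.cos (ρ ^ j * y i + (θ i j : ℝ))| ≤
      (2 * ∑' j : ℕ, ρ ^ (-(j : ℝ) * (s - t))) * dist x y ^ t := by
    intro i
    have hxy : |x i - y i| ≤ dist x y := by
      rw [← Real.dist_eq]
      exact PiLp.dist_apply_le x y i
    rw [← (summable_weierstrass hρ (ht.trans hts) θ x i).tsum_sub
      (summable_weierstrass hρ (ht.trans hts) θ y i), ← Real.norm_eq_abs, mul_right_comm]
    refine tsum_of_norm_bounded (hsum.hasSum.mul_left (2 * dist x y ^ t)) fun j => ?_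
    rw [← mul_sub, norm_mul, Real.norm_of_nonneg (by positivity), Real.norm_eq_abs]
    have hd : ρ ^ j * x i + (θ i j : ℝ) - (ρ ^ j * y i + (θ i j : ℝ)) = ρ ^ j * (x i - y i) := by
      ring
    have h1 := abs_cos_sub_cos_le_rpow (ρ ^ j * x i + (θ i j : ℝ)) (ρ ^ j * y i + (θ i j : ℝ))
      ht.le ht₁
    rw [hd, abs_mul, abs_of_pos (by positivity : 0 < ρ ^ j),
      Real.mul_rpow (by positivity) (abs_nonneg _), ← Real.rpow_natCast ρ j,
      ← Real.rpow_mul h0.le] at h1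
    have h2 : ρ ^ (-(j : ℝ) * s) * ρ ^ ((j : ℝ) * t) = ρ ^ (-(j : ℝ) * (s - t)) := by
      rw [← Real.rpow_add h0]
      congr 1
      ring
    simp only [Real.rpow_natCast] at h1 ⊢
    calc _ ≤ ρ ^ (-(j : ℝ) * s) * (2 * (ρ ^ ((j : ℝ) * t) * |x i - y i| ^ t)) := by gcongr
      _ = 2 * |x i - y i| ^ t * (ρ ^ (-(j : ℝ) * s) * ρ ^ ((j : ℝ) * t)) := by ring
      _ ≤ 2 * dist x y ^ t * (ρ ^ (-(j : ℝ) * s) * ρ ^ ((j : ℝ) * t)) := by gcongr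
      _ = _ := by rw [h2]
  unfold weierstrass
  rw [← Finset.sum_sub_distrib]
  calc _ ≤ ∑ _i : Fin n, (2 * ∑' j : ℕ, ρ ^ (-(j : ℝ) * (s - t))) * dist x y ^ t :=
        (Finset.abs_sum_le_sum_abs _ _).trans (Finset.sum_le_sum fun i _ => hterm i)
    _ = n * (2 * ∑' j : ℕ, ρ ^ (-(j : ℝ) * (s - t))) * dist x y ^ t := by
        rw [Finset.sum_const, nsmul_eq_mul, Finset.card_univ, Fintype.card_fin]
        ring
    _ ≤ _ := by
        gcongr
        linarith

/-! ### Distribution of the increments -/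

theorem weierstrass_resample {n : ℕ} {ρ s : ℝ} (hρ : 1 < ρ) (hs : 0 < s) (i : Fin n) (j : ℕ)
    (θ : PhaseSpace n) (u : PhaseInterval) (x : EuclideanSpace ℝ (Fin n)) :
    weierstrass ρ s (resample i j θ u) x = weierstrass ρ s θ x + ρ ^ (-(j : ℝ) * s) *
      (Real.cos (ρ ^ j * x i + u) - Real.cos (ρ ^ j * x i + (θ i j : ℝ))) := by
  rw [← sub_eq_iff_eq_add']
  unfold weierstrass
  rw [← Finset.sum_sub_distrib, Finset.sum_eq_single i]
  · rw [← (summable_weierstrass hρ hs _ x i).tsum_sub (summable_weierstrass hρ hs θ x i),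
      tsum_eq_single j]
    · simp [resample, mul_sub]
    · intro k hk
      simp [resample, hk]
  · intro k _ hk
    simp [resample, hk]
  · simp

/-- This selects the coordinate whose phases are used. If it failed, the squares of the coordinates
would sum to less than `‖z‖² / n`. -/
theorem exists_norm_le_mul_abs_apply {n : ℕ} {z : EuclideanSpace ℝ (Fin n)} (hz : z ≠ 0) :
    ∃ i, ‖z‖ ≤ n * |z i| := by
  by_contra! h
  have hn : 1 ≤ (n : ℝ) := by
    rcases Nat.eq_zero_or_pos n with rfl | hn
    · exact absurd (Subsingleton.elim z 0) hz
    · exact_mod_cast hn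
  have hz' : 0 < ‖z‖ := norm_pos_iff.2 hz
  have h1 : ∀ i, z i ^ 2 ≤ ‖z‖ ^ 2 / n ^ 2 := by
    intro i
    rw [le_div_iff₀ (by positivity), ← sq_abs (z i), ← mul_pow, mul_comm]
    exact pow_le_pow_left₀ (by positivity) (h i).le 2
  have hne : (Finset.univ : Finset (Fin n)).Nonempty := by
    have : 0 < n := by exact_mod_cast (zero_lt_one.trans_le hn)
    exact ⟨⟨0, this⟩, Finset.mem_univ _⟩
  have h1' : ∀ i, z i ^ 2 < ‖z‖ ^ 2 / n ^ 2 := by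
    intro i
    rw [lt_div_iff₀ (by positivity), ← sq_abs (z i), ← mul_pow, mul_comm]
    exact pow_lt_pow_left₀ (h i) (by positivity) two_ne_zero
  have h2 : ‖z‖ ^ 2 < ∑ _i : Fin n, ‖z‖ ^ 2 / n ^ 2 := by
    rw [EuclideanSpace.real_norm_sq_eq z] at h1' ⊢
    exact Finset.sum_lt_sum_of_nonempty hne fun i _ => h1' i
  rw [Finset.sum_const, nsmul_eq_mul, Finset.card_univ, Fintype.card_fin] at h2
  have h3 : (n : ℝ) * (‖z‖ ^ 2 / n ^ 2) ≤ ‖z‖ ^ 2 := by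
    have : (n : ℝ) * (‖z‖ ^ 2 / n ^ 2) = ‖z‖ ^ 2 / n := by field_simp
    rw [this]
    exact div_le_self (by positivity) hn
  linarith

/-- With `ρ^J ≤ 1/|w| < ρ^(J+1)`, each `j` with `J - m < j ≤ J` satisfies `ρ^(-m) ≤ ρ^j |w| ≤ 1`.
The lower bound controls the sine, the upper one gives `ρ^(-js) ≥ |w|^s`; the assumption on `|w|`
ensures `m ≤ J`. -/
theorem exists_finset_amplitude_ge {ρ s : ℝ} (hρ : 1 < ρ) (hs : 0 < s) (m : ℕ) {w : ℝ}
    (hw : w ≠ 0) (hwm : |w| ≤ (ρ ^ m)⁻¹) :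
    ∃ T : Finset ℕ, T.card = m ∧ ∀ j ∈ T, 2 * (ρ ^ m)⁻¹ / Real.pi * |w| ^ s ≤
      |-2 * ρ ^ (-(j : ℝ) * s) * Real.sin (ρ ^ j * w / 2)| := by
  have h0 : (0 : ℝ) < ρ := by linarith
  have hpi := Real.pi_pos
  have hh0 : 0 < |w| := abs_pos.2 hw
  have hinv : ρ ^ m ≤ |w|⁻¹ := by
    rw [le_inv_comm₀ (by positivity) hh0]
    exact hwm
  obtain ⟨J, hJ1, hJ2⟩ := exists_nat_pow_near ((one_le_pow₀ hρ.le).trans hinv) hρ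
  have hmJ : m ≤ J := by
    have : m < J + 1 := (pow_lt_pow_iff_right₀ hρ).1 (hinv.trans_lt hJ2)
    omega
  refine ⟨Finset.Ioc (J - m) J, by rw [Nat.card_Ioc]; omega, fun j hj => ?_⟩
  rw [Finset.mem_Ioc] at hj
  have hpow : ρ ^ j ≤ |w|⁻¹ := (pow_le_pow_right₀ hρ.le hj.2).trans hJ1
  have hjle : ρ ^ j * |w| ≤ 1 := by
    calc ρ ^ j * |w| ≤ |w|⁻¹ * |w| := by gcongr
      _ = 1 := inv_mul_cancel₀ hh0.ne'
  have hjge : (ρ ^ m)⁻¹ ≤ ρ ^ j * |w| := by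
    rw [inv_le_iff_one_le_mul₀ (by positivity)]
    have h1 : |w|⁻¹ ≤ ρ ^ (j + m) := hJ2.le.trans (pow_le_pow_right₀ hρ.le (by omega))
    rw [inv_le_iff_one_le_mul₀ hh0, pow_add] at h1
    linarith
  have habs : |ρ ^ j * w / 2| = ρ ^ j * |w| / 2 := by
    rw [abs_div, abs_mul, abs_two, abs_of_pos (by positivity : 0 < ρ ^ j)]
  have hsin : (ρ ^ m)⁻¹ / Real.pi ≤ |Real.sin (ρ ^ j * w / 2)| := by
    have h1 := Real.mul_abs_le_abs_sin (x := ρ ^ j * w / 2) (by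
      rw [habs]; linarith [Real.pi_gt_three])
    rw [habs] at h1
    refine le_trans ?_ h1
    have : 2 / Real.pi * (ρ ^ j * |w| / 2) = ρ ^ j * |w| / Real.pi := by ring
    rw [this]
    gcongr
  have hamp : |w| ^ s ≤ ρ ^ (-(j : ℝ) * s) := by
    have h1 : |w| ≤ (ρ ^ j)⁻¹ := by rwa [le_inv_comm₀ hh0 (by positivity)]
    have h2 : ρ ^ (-(j : ℝ) * s) = ((ρ ^ j)⁻¹) ^ s := by
      rw [← Real.rpow_natCast, ← Real.rpow_neg h0.le, ← Real.rpow_mul h0.le]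
    rw [h2]
    gcongr
  rw [abs_mul, abs_mul, abs_neg, abs_two, abs_of_pos (by positivity : 0 < ρ ^ (-(j : ℝ) * s))]
  calc 2 * (ρ ^ m)⁻¹ / Real.pi * |w| ^ s = 2 * |w| ^ s * ((ρ ^ m)⁻¹ / Real.pi) := by ring
    _ ≤ _ := by gcongr

theorem weierstrass_sub_resample {n : ℕ} {ρ s : ℝ} (hρ : 1 < ρ) (hs : 0 < s) (i : Fin n) (j : ℕ)
    (θ : PhaseSpace n) (x y : EuclideanSpace ℝ (Fin n)) :
    ∃ a, ∀ u, weierstrass ρ s (resample i j θ u) x - weierstrass ρ s (resample i j θ u) y =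
      -2 * ρ ^ (-(j : ℝ) * s) * Real.sin (ρ ^ j * (x i - y i) / 2) *
        Real.sin (ρ ^ j * (x i + y i) / 2 + u) - a := by
  -- `a` is minus the increment without its `(i, j)` term, hence independent of `u`.
  refine ⟨-(weierstrass ρ s θ x - weierstrass ρ s θ y - ρ ^ (-(j : ℝ) * s) *
    (Real.cos (ρ ^ j * x i + (θ i j : ℝ)) - Real.cos (ρ ^ j * y i + (θ i j : ℝ)))),
    fun u => ?_⟩
  have hcos := Real.cos_sub_cos (ρ ^ j * x i + u) (ρ ^ j * y i + u)
  have e1 : (ρ ^ j * x i + u + (ρ ^ j * y i + u)) / 2 = ρ ^ j * (x i + y i) / 2 + u := by ring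
  have e2 : (ρ ^ j * x i + u - (ρ ^ j * y i + u)) / 2 = ρ ^ j * (x i - y i) / 2 := by ring
  rw [e1, e2] at hcos
  rw [weierstrass_resample hρ hs, weierstrass_resample hρ hs]
  linear_combination ρ ^ (-(j : ℝ) * s) * hcos

/-- With the optimal threshold, `m` sinusoids of amplitude `q₀` give the exponent `m / (m + 1)`. -/
theorem phaseMeasure_abs_le_of_sinusoidal_rpow {n : ℕ} (i : Fin n) (T : Finset ℕ)
    {g : PhaseSpace n → ℝ} (hg : Measurable g) {q₀ r : ℝ} (hq₀ : 0 < q₀)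
    (hr : 0 < r) (α q : ℕ → ℝ) (hq : ∀ j ∈ T, q₀ ≤ |q j|)
    (h : ∀ j ∈ T, ∀ θ, ∃ a, ∀ u, g (resample i j θ u) = q j * Real.sin (α j + u) - a) :
    phaseMeasure n {θ | |g θ| ≤ r} ≤
      ENNReal.ofReal (((28 * Real.pi) ^ T.card + T.card * (14 * Real.pi)) *
        (r / q₀) ^ ((T.card : ℝ) / (T.card + 1))) := by
  set m := T.card with hm
  set τ := r / q₀ with hτ
  have hτ0 : 0 < τ := by positivity
  -- For `η = τ^(1/(m+1))` the competing terms `η^m` and `τ/η` both equal `τ^(m/(m+1))`.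
  have hη0 : 0 < τ ^ (1 / ((m : ℝ) + 1)) := by positivity
  refine (phaseMeasure_abs_le_of_sinusoidal i T hg hq₀ hη0 hr.le α q hq h).trans
    (ENNReal.ofReal_le_ofReal (le_of_eq ?_))
  have hηm : (τ ^ (1 / ((m : ℝ) + 1))) ^ m = τ ^ ((m : ℝ) / (m + 1)) := by
    rw [← Real.rpow_natCast, ← Real.rpow_mul hτ0.le]
    congr 1
    ring
  have hτη : r / (q₀ * τ ^ (1 / ((m : ℝ) + 1))) = τ ^ ((m : ℝ) / (m + 1)) := by
    rw [← div_div, ← hτ]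
    nth_rewrite 1 [← Real.rpow_one τ]
    rw [← Real.rpow_sub hτ0]
    congr 1
    field_simp
    ring
  rw [← hm, mul_pow, hηm, hτη]
  ring

/-- The number `m` of phases is chosen with `m/(m+1) ≥ β`, and `δ = ρ^(-m)` leaves room for `m`
suitable frequencies. -/
theorem phaseMeasure_weierstrass_sub_le {n : ℕ} {ρ s β : ℝ} (hρ : 1 < ρ) (hs : 0 < s)
    (hβ₀ : 0 < β) (hβ₁ : β < 1) :
    ∃ C δ : ℝ, 0 < C ∧ 0 < δ ∧ ∀ x y : EuclideanSpace ℝ (Fin n), x ≠ y → dist x y ≤ δ →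
      ∀ r, 0 < r → phaseMeasure n {θ | |weierstrass ρ s θ x - weierstrass ρ s θ y| ≤ r} ≤
        ENNReal.ofReal (C * (r / dist x y ^ s) ^ β) := by
  have h0 : (0 : ℝ) < ρ := by linarith
  have hpi := Real.pi_pos
  obtain ⟨m, hm⟩ : ∃ m : ℕ, β ≤ m / (m + 1) := by
    obtain ⟨m, hm⟩ := exists_nat_one_div_lt (sub_pos.2 hβ₁)
    refine ⟨m, ?_⟩
    have : (m : ℝ) / (m + 1) = 1 - 1 / (m + 1) := by field_simp; ring
    rw [this]
    linarith
  rcases Nat.eq_zero_or_pos n with rfl | hn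
  · exact ⟨1, 1, one_pos, one_pos, fun x y hxy => absurd (Subsingleton.elim x y) hxy⟩
  have hn' : (0 : ℝ) < n := by exact_mod_cast hn
  obtain ⟨c, hc0, hc⟩ : ∃ c, 0 < c ∧ c = 2 * (ρ ^ m)⁻¹ / Real.pi * ((n : ℝ) ^ s)⁻¹ :=
    ⟨_, by positivity, rfl⟩
  refine ⟨1 + ((28 * Real.pi) ^ m + m * (14 * Real.pi)) * (1 / c) ^ ((m : ℝ) / (m + 1)),
    (ρ ^ m)⁻¹, by positivity, by positivity, fun x y hxy hd r hr => ?_⟩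
  have hD : 0 < dist x y := dist_pos.2 hxy
  have hτ0 : 0 < r / dist x y ^ s := by positivity
  have hB : 0 ≤ ((28 * Real.pi) ^ m + m * (14 * Real.pi)) * (1 / c) ^ ((m : ℝ) / (m + 1)) := by
    positivity
  -- For a ratio at least 1 the summand 1 in the constant makes the bound trivial. Below 1 the
  -- exponent `m/(m+1)` may be lowered to `β`.
  rcases le_or_gt 1 (r / dist x y ^ s) with hτ1 | hτ1
  · refine prob_le_one.trans ?_
    rw [ENNReal.one_le_ofReal]
    have h1 : 1 ≤ (r / dist x y ^ s) ^ β := Real.one_le_rpow hτ1 hβ₀.le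
    nlinarith
  obtain ⟨i, hi⟩ := exists_norm_le_mul_abs_apply (sub_ne_zero.2 hxy)
  rw [← dist_eq_norm, PiLp.sub_apply] at hi
  have hhD : |x i - y i| ≤ dist x y := by
    rw [← Real.dist_eq]
    exact PiLp.dist_apply_le x y i
  have hh0 : x i - y i ≠ 0 := by
    intro h
    rw [h, abs_zero, mul_zero] at hi
    linarith
  obtain ⟨T, hT, hq⟩ := exists_finset_amplitude_ge hρ hs m hh0 (hhD.trans hd)
  have hgm : Measurable fun θ : PhaseSpace n => weierstrass ρ s θ x - weierstrass ρ s θ y := by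
    exact ((continuous_weierstrass_phase hρ hs x).sub
      (continuous_weierstrass_phase hρ hs y)).measurable
  have hqT : ∀ j ∈ T, c * dist x y ^ s ≤
      |-2 * ρ ^ (-(j : ℝ) * s) * Real.sin (ρ ^ j * (x i - y i) / 2)| := by
    intro j hj
    refine le_trans ?_ (hq j hj)
    have hDh : dist x y ^ s ≤ (n : ℝ) ^ s * |x i - y i| ^ s := by
      rw [← Real.mul_rpow hn'.le (abs_nonneg _)]
      gcongr
    calc c * dist x y ^ s ≤ c * ((n : ℝ) ^ s * |x i - y i| ^ s) := by gcongr
      _ = 2 * (ρ ^ m)⁻¹ / Real.pi * |x i - y i| ^ s := by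
          rw [hc]
          field_simp
  have hmain := phaseMeasure_abs_le_of_sinusoidal_rpow i T hgm
    (by positivity : 0 < c * dist x y ^ s) hr (fun j => ρ ^ j * (x i + y i) / 2)
    (fun j => -2 * ρ ^ (-(j : ℝ) * s) * Real.sin (ρ ^ j * (x i - y i) / 2)) hqT
    fun j _ θ => weierstrass_sub_resample hρ hs i j θ x y
  refine hmain.trans (ENNReal.ofReal_le_ofReal ?_)
  rw [hT]
  have hle : (r / dist x y ^ s) ^ ((m : ℝ) / (m + 1)) ≤ (r / dist x y ^ s) ^ β :=
    Real.rpow_le_rpow_of_exponent_ge hτ0 hτ1.le hm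
  have hrc : r / (c * dist x y ^ s) = 1 / c * (r / dist x y ^ s) := by
    field_simp
  rw [hrc, Real.mul_rpow (by positivity) hτ0.le, ← mul_assoc]
  exact mul_le_mul (by linarith) hle (by positivity) (by linarith)

/-! ### Mass distribution and Riesz kernels -/

open scoped ENNReal in
/-- Mass distribution principle for the image of a measure. -/
theorem le_dimH_image_of_measure_ball_le {X Y : Type*} [MeasurableSpace X] [MetricSpace Y]
    [MeasurableSpace Y] [BorelSpace Y] {μ : Measure X} {G : X → Y} (hG : Measurable G) {K : Set X}
    (hK : μ Kᶜ = 0) (hμ : μ ≠ 0) {t : ℝ} (ht : 0 < t) (k₀ : ℕ)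
    (h : ∀ᵐ x ∂μ, ∃ M : ℕ, ∀ k, k₀ ≤ k →
      μ {y | dist (G x) (G y) ≤ (1 / 2) ^ k} ≤ M * ENNReal.ofReal (((1 / 2) ^ k) ^ t)) :
    ENNReal.ofReal t ≤ dimH (G '' K) := by
  -- The constant `M` depends on the point. The sets `S M` exhaust almost all of the space, so one
  -- of them has positive measure, and `μ` is restricted to it.
  set S : ℕ → Set X := fun M => {x | ∀ k, k₀ ≤ k →
      μ {y | dist (G x) (G y) ≤ (1 / 2) ^ k} ≤ M * ENNReal.ofReal (((1 / 2) ^ k) ^ t)} with hS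
  obtain ⟨M, hM⟩ : ∃ M, μ (S M) ≠ 0 := by
    by_contra! hcon
    have h1 : μ (⋃ M, S M) = 0 := measure_iUnion_null hcon
    have h2 : μ (⋃ M, S M)ᶜ = 0 := by
      refine measure_mono_null (fun x hx => ?_) h
      simpa [hS] using hx
    exact hμ (Measure.measure_univ_eq_zero.1 (le_antisymm
      ((measure_univ_le_add_compl _).trans (by rw [h1, h2, add_zero])) (zero_le)))
  set ν : Measure Y := (μ.restrict (S M)).map G with hν
  -- `M + 1` keeps `c` nonzero even for `M = 0`; `2 ^ t` pays for rounding a diameter up to a dyadic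
  -- scale.
  set c : ℝ≥0∞ := (M + 1) * ENNReal.ofReal (2 ^ t) with hc
  have hc0 : c ≠ 0 := by
    rw [hc]
    refine mul_ne_zero (by simp) ?_
    simpa using Real.rpow_pos_of_pos two_pos t
  have hctop : c ≠ ⊤ := by
    rw [hc]
    exact ENNReal.mul_ne_top (by simp) ENNReal.ofReal_ne_top
  have key : ∀ U : Set Y, Metric.ediam U ≤ ENNReal.ofReal ((1 / 2) ^ k₀) →
      ν U ≤ c * Metric.ediam U ^ t := by
    intro U hU
    refine (measure_mono subset_closure).trans ?_
    rw [← Metric.ediam_closure] at hU ⊢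
    set V := closure U with hV
    have hVm : MeasurableSet V := isClosed_closure.measurableSet
    rw [hν, Measure.map_apply hG hVm, Measure.restrict_apply (hG hVm)]
    rcases Set.eq_empty_or_nonempty (G ⁻¹' V ∩ S M) with he | ⟨x, hxV, hxS⟩
    · simp [he]
    have hdtop : Metric.ediam V ≠ ⊤ := ne_top_of_le_ne_top ENNReal.ofReal_ne_top hU
    obtain ⟨δ, hδ0, hδ⟩ : ∃ δ : ℝ, 0 ≤ δ ∧ Metric.ediam V = ENNReal.ofReal δ :=
      ⟨_, ENNReal.toReal_nonneg, (ENNReal.ofReal_toReal hdtop).symm⟩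
    have hsub : ∀ k : ℕ, δ ≤ (1 / 2) ^ k → G ⁻¹' V ∩ S M ⊆ {y | dist (G x) (G y) ≤ (1 / 2) ^ k} := by
      rintro k hk y ⟨hy, -⟩
      have h1 : edist (G x) (G y) ≤ Metric.ediam V := Metric.edist_le_ediam_of_mem hxV hy
      rw [hδ, edist_dist] at h1
      exact ((ENNReal.ofReal_le_ofReal_iff hδ0).1 h1).trans hk
    rw [hδ] at hU ⊢
    rw [ENNReal.ofReal_le_ofReal_iff (by positivity)] at hU
    -- A set of diameter zero lies in dyadic balls of every small radius, so it carries no mass.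
    rcases hδ0.eq_or_lt with h0 | hpos
    · have hz : μ (G ⁻¹' V ∩ S M) = 0 := by
        have hlim : Filter.Tendsto (fun k : ℕ => (M : ℝ≥0∞) * ENNReal.ofReal (((1 / 2) ^ k) ^ t))
            Filter.atTop (nhds 0) := by
          have h1 : Filter.Tendsto (fun k : ℕ => ((1 / 2 : ℝ) ^ k) ^ t) Filter.atTop (nhds 0) := by
            have := (tendsto_pow_atTop_nhds_zero_of_lt_one (r := (1 / 2 : ℝ)) (by norm_num)
              (by norm_num)).rpow_const (p := t) (Or.inr ht.le)
            rwa [Real.zero_rpow ht.ne'] at this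
          have h2 := ENNReal.Tendsto.const_mul (a := (M : ℝ≥0∞)) (ENNReal.tendsto_ofReal h1)
            (Or.inr (by simp))
          simpa using h2
        refine le_antisymm (ge_of_tendsto hlim ?_) (zero_le)
        filter_upwards [Filter.eventually_ge_atTop k₀] with k hk
        exact (measure_mono (hsub k (by rw [← h0]; positivity))).trans (hxS k hk)
      rw [hz]
      exact zero_le
    · obtain ⟨k, hk1, hk2⟩ := exists_nat_pow_near_of_lt_one hpos
        (hU.trans (pow_le_one₀ (by norm_num) (by norm_num))) (by norm_num : (0 : ℝ) < 1 / 2)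
        (by norm_num)
      have hk : k₀ ≤ k := by
        have := (pow_lt_pow_iff_right_of_lt_one₀ (by norm_num : (0 : ℝ) < 1 / 2)
          (by norm_num)).1 (hk1.trans_le hU)
        omega
      refine ((measure_mono (hsub k hk2)).trans (hxS k hk)).trans ?_
      rw [ENNReal.ofReal_rpow_of_nonneg hδ0 ht.le, hc, mul_assoc,
        ← ENNReal.ofReal_mul (by positivity), ← Real.mul_rpow two_pos.le hδ0]
      gcongr
      · exact le_self_add
      · rw [pow_succ] at hk1
        linarith
  have hle : c⁻¹ • ν ≤ Measure.hausdorffMeasure t := by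
    refine Measure.le_hausdorffMeasure t _ (ENNReal.ofReal ((1 / 2) ^ k₀)) (by simp) fun U hU => ?_
    rw [Measure.smul_apply, smul_eq_mul, mul_comm, ← div_eq_mul_inv]
    refine ENNReal.div_le_of_le_mul' (key U hU)
  have hpos : Measure.hausdorffMeasure t (G '' K) ≠ 0 := by
    intro h0
    have h1 : c⁻¹ * ν (G '' K) = 0 := le_antisymm ((hle (G '' K)).trans h0.le) (zero_le)
    have h2 : ν (G '' K) = 0 := by
      rcases mul_eq_zero.1 h1 with h | h
      · exact absurd (ENNReal.inv_eq_zero.1 h) hctop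
      · exact h
    have h3 : μ.restrict (S M) K = 0 :=
      measure_mono_null (Set.subset_preimage_image G K)
        (le_antisymm ((Measure.le_map_apply hG.aemeasurable _).trans h2.le) (zero_le))
    have h4 : μ.restrict (S M) Kᶜ = 0 :=
      le_antisymm ((Measure.restrict_apply_le _ _).trans hK.le) (zero_le)
    have h5 : μ.restrict (S M) Set.univ = 0 :=
      le_antisymm ((measure_univ_le_add_compl K).trans (by rw [h3, h4, add_zero])) (zero_le)
    rw [Measure.restrict_apply_univ] at h5
    exact hM h5
  have hcoe : ((t.toNNReal : NNReal) : ℝ) = t := Real.coe_toNNReal t ht.le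
  exact le_dimH_of_hausdorffMeasure_ne_zero (by rwa [hcoe])

/-- The Riesz kernel of order `γ < d` over a ball about a point of upper regularity `d`. -/
theorem lintegral_closedBall_dist_rpow_le {X : Type*} [MetricSpace X] [MeasurableSpace X]
    [BorelSpace X] {d γ c : ℝ} (hγ : 0 < γ) (hγd : γ < d) (hc : 0 < c) :
    ∃ C : ℝ, 0 < C ∧ ∀ (μ : Measure X) (x : X),
      (∀ r : ℝ, 0 < r → r ≤ 1 → μ (Metric.closedBall x r) ≤ ENNReal.ofReal (c * r ^ d)) →
      ∀ r, 0 < r → r ≤ 1 → ∫⁻ y in Metric.closedBall x r, ENNReal.ofReal (dist x y ^ (-γ)) ∂μ ≤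
        ENNReal.ofReal (C * r ^ (d - γ)) := by
  set a : ℝ := (1 / 2) ^ (d - γ) with ha
  have ha0 : 0 < a := by positivity
  have ha1 : a < 1 := Real.rpow_lt_one (by norm_num) (by norm_num) (by linarith)
  refine ⟨c * 2 ^ γ * (1 - a)⁻¹, by have := sub_pos.2 ha1; positivity, fun μ x hμ r hr hr1 => ?_⟩
  set B : ℕ → Set X := fun j => Metric.closedBall x ((1 / 2) ^ j * r) with hB
  set w : ℕ → ℝ := fun j => ((1 / 2) ^ (j + 1) * r) ^ (-γ) with hw
  -- If `y` is at distance between `2^(-j-1) r` and `2^(-j) r` from `x`, the term `j` alone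
  -- dominates the kernel. At `y = x` the real power takes the value 0.
  have hpt : ∀ y ∈ Metric.closedBall x r, ENNReal.ofReal (dist x y ^ (-γ)) ≤
      ∑' j, (B j).indicator (fun _ => ENNReal.ofReal (w j)) y := by
    intro y hy
    rw [Metric.mem_closedBall, dist_comm] at hy
    rcases (dist_nonneg (x := x) (y := y)).eq_or_lt with h0 | hpos
    · rw [← h0, Real.zero_rpow (by linarith)]
      simp
    · obtain ⟨j, hj1, hj2⟩ := exists_nat_pow_near_of_lt_one (div_pos hpos hr)
        ((div_le_one hr).2 hy) (by norm_num : (0 : ℝ) < 1 / 2) (by norm_num)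
      rw [lt_div_iff₀ hr] at hj1
      rw [div_le_iff₀ hr] at hj2
      refine le_trans ?_ (ENNReal.le_tsum j)
      rw [Set.indicator_of_mem (by rw [hB, Metric.mem_closedBall, dist_comm]; exact hj2)]
      exact ENNReal.ofReal_le_ofReal
        (Real.rpow_le_rpow_of_nonpos (by positivity) hj1.le (by linarith))
  have hterm : ∀ j, ENNReal.ofReal (w j) * μ (B j) ≤
      ENNReal.ofReal (c * 2 ^ γ * r ^ (d - γ) * a ^ j) := by
    intro j
    have hρ0 : 0 < (1 / 2 : ℝ) ^ j * r := by positivity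
    have hρ1 : (1 / 2 : ℝ) ^ j * r ≤ 1 :=
      mul_le_one₀ (pow_le_one₀ (by norm_num) (by norm_num)) hr.le hr1
    refine (mul_le_mul_right (hμ _ hρ0 hρ1) _).trans ?_
    rw [← ENNReal.ofReal_mul (by positivity)]
    refine ENNReal.ofReal_le_ofReal (le_of_eq ?_)
    have e1 : w j = 2 ^ γ * ((1 / 2 : ℝ) ^ j * r) ^ (-γ) := by
      have : (1 / 2 : ℝ) ^ (j + 1) * r = 2⁻¹ * ((1 / 2 : ℝ) ^ j * r) := by ring
      simp only [hw]
      rw [this, Real.mul_rpow (by norm_num) hρ0.le, Real.inv_rpow (by norm_num),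
        Real.rpow_neg (by norm_num), inv_inv]
    have e2 : ((1 / 2 : ℝ) ^ j * r) ^ (-γ) * ((1 / 2 : ℝ) ^ j * r) ^ d = r ^ (d - γ) * a ^ j := by
      rw [← Real.rpow_add hρ0, show -γ + d = d - γ by ring, Real.mul_rpow (by positivity) hr.le, ha,
        ← Real.rpow_natCast, ← Real.rpow_natCast, ← Real.rpow_mul (by norm_num),
        ← Real.rpow_mul (by norm_num), mul_comm (j : ℝ), mul_comm]
    rw [e1]
    linear_combination c * 2 ^ γ * e2
  calc ∫⁻ y in Metric.closedBall x r, ENNReal.ofReal (dist x y ^ (-γ)) ∂μ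
      ≤ ∫⁻ y in Metric.closedBall x r, ∑' j, (B j).indicator (fun _ => ENNReal.ofReal (w j)) y ∂μ :=
        setLIntegral_mono' Metric.isClosed_closedBall.measurableSet hpt
    _ ≤ ∫⁻ y, ∑' j, (B j).indicator (fun _ => ENNReal.ofReal (w j)) y ∂μ :=
        setLIntegral_le_lintegral _ _
    _ = ∑' j, ENNReal.ofReal (w j) * μ (B j) := by
        have hBm : ∀ j, MeasurableSet (B j) := fun j => Metric.isClosed_closedBall.measurableSet
        rw [lintegral_tsum fun j => (measurable_const.indicator (hBm j)).aemeasurable]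
        refine tsum_congr fun j => ?_
        rw [lintegral_indicator_const (hBm j)]
    _ ≤ ∑' j, ENNReal.ofReal (c * 2 ^ γ * r ^ (d - γ) * a ^ j) := ENNReal.tsum_le_tsum hterm
    _ = ENNReal.ofReal (∑' j, c * 2 ^ γ * r ^ (d - γ) * a ^ j) :=
        (ENNReal.ofReal_tsum_of_nonneg (fun j => by positivity)
          ((summable_geometric_of_lt_one ha0.le ha1).mul_left _)).symm
    _ = _ := by
        rw [tsum_mul_left, tsum_geometric_of_lt_one ha0.le ha1]
        congr 1
        ring

/-! ### The lower bound -/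

/-- The pairs of points whose images on the graph of the Weierstrass function are close. -/
def closePairs {n : ℕ} (ρ s r : ℝ) :
    Set (PhaseSpace n × EuclideanSpace ℝ (Fin n) × EuclideanSpace ℝ (Fin n)) :=
  {p | dist p.2.1 p.2.2 ≤ r ∧ |weierstrass ρ s p.1 p.2.1 - weierstrass ρ s p.1 p.2.2| ≤ r}

theorem measurableSet_closePairs {n : ℕ} {ρ s : ℝ} (hρ : 1 < ρ) (hs : 0 < s) (r : ℝ) :
    MeasurableSet (closePairs (n := n) ρ s r) := by
  have h₁ : Continuous fun p : PhaseSpace n × EuclideanSpace ℝ (Fin n) × EuclideanSpace ℝ (Fin n) =>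
      (p.1, p.2.1) := by fun_prop
  have h₂ : Continuous fun p : PhaseSpace n × EuclideanSpace ℝ (Fin n) × EuclideanSpace ℝ (Fin n) =>
      (p.1, p.2.2) := by fun_prop
  have hW₁ := (continuous_weierstrass (n := n) hρ hs).comp h₁
  have hW₂ := (continuous_weierstrass (n := n) hρ hs).comp h₂
  have hd : Continuous fun p : PhaseSpace n × EuclideanSpace ℝ (Fin n) × EuclideanSpace ℝ (Fin n) =>
      dist p.2.1 p.2.2 := by fun_prop
  have hc := (isClosed_le hd (continuous_const (y := r))).inter
    (isClosed_le (hW₁.sub hW₂).abs (continuous_const (y := r)))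
  exact hc.measurableSet

/-- By Tonelli the probability is taken first. It leaves `r^β |x - y|^(-sβ)` on the ball of radius
`r`, a Riesz kernel of order `sβ < d`, whose integral contributes `r^(d - sβ)`. -/
theorem lintegral_measure_closePairs_le {n : ℕ} {ρ s d β c : ℝ} (hρ : 1 < ρ) (hs : 0 < s)
    (hβ₀ : 0 < β) (hβ₁ : β < 1) (hβd : s * β < d) (hc : 0 < c)
    {μ : Measure (EuclideanSpace ℝ (Fin n))} [IsFiniteMeasure μ]
    {K : Set (EuclideanSpace ℝ (Fin n))} (hK : μ Kᶜ = 0)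
    (hμ : ∀ x ∈ K, ∀ r : ℝ, 0 < r → r ≤ 1 →
      μ (Metric.closedBall x r) ≤ ENNReal.ofReal (c * r ^ d)) :
    ∃ C δ : ℝ, 0 < C ∧ 0 < δ ∧ ∀ r, 0 < r → r ≤ δ →
      ∫⁻ θ, (μ.prod μ) (Prod.mk θ ⁻¹' closePairs ρ s r) ∂(phaseMeasure n) ≤
        ENNReal.ofReal (C * r ^ (d + (1 - s) * β)) := by
  obtain ⟨C₁, δ, hC₁, hδ, hP⟩ := phaseMeasure_weierstrass_sub_le (n := n) hρ hs hβ₀ hβ₁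
  obtain ⟨C₂, hC₂, hR⟩ := lintegral_closedBall_dist_rpow_le (X := EuclideanSpace ℝ (Fin n))
    (mul_pos hs hβ₀) hβd hc
  have hd : 0 < d := (mul_pos hs hβ₀).trans hβd
  refine ⟨C₁ * C₂ * (μ Set.univ).toReal + 1, min δ 1, by positivity, lt_min hδ one_pos,
    fun r hr hrδ => ?_⟩
  have hrδ' := hrδ.trans (min_le_left _ _)
  have hr1 := hrδ.trans (min_le_right _ _)
  have hm := measurableSet_closePairs (n := n) hρ hs r
  rw [← Measure.prod_apply hm, Measure.prod_apply_symm hm,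
    lintegral_prod _ (measurable_measure_prodMk_right hm).aemeasurable]
  have hinner : ∀ x ∈ K, ∫⁻ y, phaseMeasure n ((fun θ => (θ, (x, y))) ⁻¹' closePairs ρ s r) ∂μ ≤
      ENNReal.ofReal (C₁ * C₂ * r ^ (d + (1 - s) * β)) := by
    intro x hx
    -- The increment estimate fails on the diagonal, which must therefore be null.
    have hx0 : μ {x} = 0 := by
      have hlim : Filter.Tendsto (fun k : ℕ => ENNReal.ofReal (c * ((1 / 2 : ℝ) ^ k) ^ d))
          Filter.atTop (nhds 0) := by
        have := (tendsto_pow_atTop_nhds_zero_of_lt_one (r := (1 / 2 : ℝ)) (by norm_num)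
          (by norm_num)).rpow_const (p := d) (Or.inr hd.le)
        rw [Real.zero_rpow hd.ne'] at this
        simpa using ENNReal.tendsto_ofReal (this.const_mul c)
      refine le_antisymm (ge_of_tendsto' hlim fun k => ?_) (zero_le)
      refine (measure_mono ?_).trans (hμ x hx ((1 / 2) ^ k) (by positivity)
        (pow_le_one₀ (by norm_num) (by norm_num)))
      rw [Set.singleton_subset_iff]
      exact Metric.mem_closedBall_self (by positivity)
    have hpt : ∀ᵐ y ∂μ, phaseMeasure n ((fun θ => (θ, (x, y))) ⁻¹' closePairs ρ s r) ≤
        (Metric.closedBall x r).indicator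
          (fun y => ENNReal.ofReal (C₁ * r ^ β) * ENNReal.ofReal (dist x y ^ (-(s * β)))) y := by
      filter_upwards [compl_mem_ae_iff.2 hx0] with y hy
      by_cases hyr : dist x y ≤ r
      · rw [Set.indicator_of_mem (by rwa [Metric.mem_closedBall, dist_comm])]
        have hne : x ≠ y := fun h => hy (by simp [h])
        refine (measure_mono fun θ hθ => hθ.2).trans
          ((hP x y hne (hyr.trans hrδ') r hr).trans (le_of_eq ?_))
        have hD : 0 < dist x y := dist_pos.2 hne
        rw [← ENNReal.ofReal_mul (by positivity), Real.div_rpow hr.le (by positivity),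
          ← Real.rpow_mul hD.le, Real.rpow_neg hD.le]
        congr 1
        field_simp
      · have he : ((fun θ => (θ, (x, y))) ⁻¹' closePairs ρ s r : Set (PhaseSpace n)) = ∅ :=
          Set.eq_empty_of_forall_notMem fun θ hθ => hyr hθ.1
        rw [he, measure_empty]
        exact zero_le
    refine (lintegral_mono_ae hpt).trans ?_
    rw [lintegral_indicator Metric.isClosed_closedBall.measurableSet,
      lintegral_const_mul' _ _ ENNReal.ofReal_ne_top]
    refine (mul_le_mul_right (hR μ x (hμ x hx) r hr hr1) _).trans (le_of_eq ?_)
    rw [← ENNReal.ofReal_mul (by positivity)]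
    congr 1
    have : r ^ β * r ^ (d - s * β) = r ^ (d + (1 - s) * β) := by
      rw [← Real.rpow_add hr]
      congr 1
      ring
    linear_combination C₁ * C₂ * this
  calc _ ≤ ∫⁻ _x, ENNReal.ofReal (C₁ * C₂ * r ^ (d + (1 - s) * β)) ∂μ := by
        refine lintegral_mono_ae ?_
        filter_upwards [compl_mem_ae_iff.2 hK] with x hx
        exact hinner x (not_not.1 hx)
    _ = ENNReal.ofReal (C₁ * C₂ * r ^ (d + (1 - s) * β)) * ENNReal.ofReal (μ Set.univ).toReal := by
        rw [lintegral_const, ENNReal.ofReal_toReal (measure_ne_top μ _)]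
    _ ≤ _ := by
        rw [← ENNReal.ofReal_mul (by positivity)]
        refine ENNReal.ofReal_le_ofReal ?_
        have : 0 < r ^ (d + (1 - s) * β) := by positivity
        nlinarith

/-- The parametrization of the graph of `f`. -/
def graphMap {n : ℕ} (f : EuclideanSpace ℝ (Fin n) → ℝ) (x : EuclideanSpace ℝ (Fin n)) :
    EuclideanSpace ℝ (Fin (n + 1)) :=
  WithLp.toLp 2 (Fin.snoc (α := fun _ => ℝ) (fun i => x i) (f x))

theorem graphOn_eq_image {n : ℕ} (f : EuclideanSpace ℝ (Fin n) → ℝ)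
    (K : Set (EuclideanSpace ℝ (Fin n))) : graphOn f K = graphMap f '' K := rfl

theorem dist_graphMap_sq {n : ℕ} (f : EuclideanSpace ℝ (Fin n) → ℝ)
    (x y : EuclideanSpace ℝ (Fin n)) :
    dist (graphMap f x) (graphMap f y) ^ 2 = dist x y ^ 2 + |f x - f y| ^ 2 := by
  rw [EuclideanSpace.dist_eq, EuclideanSpace.dist_eq, Real.sq_sqrt (by positivity),
    Real.sq_sqrt (by positivity), Fin.sum_univ_castSucc]
  simp [graphMap, Real.dist_eq]

theorem dist_le_dist_graphMap {n : ℕ} (f : EuclideanSpace ℝ (Fin n) → ℝ)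
    (x y : EuclideanSpace ℝ (Fin n)) : dist x y ≤ dist (graphMap f x) (graphMap f y) := by
  have := dist_graphMap_sq f x y
  refine le_of_sq_le_sq ?_ dist_nonneg
  nlinarith [sq_nonneg |f x - f y|]

theorem abs_sub_le_dist_graphMap {n : ℕ} (f : EuclideanSpace ℝ (Fin n) → ℝ)
    (x y : EuclideanSpace ℝ (Fin n)) : |f x - f y| ≤ dist (graphMap f x) (graphMap f y) := by
  have := dist_graphMap_sq f x y
  refine le_of_sq_le_sq ?_ dist_nonneg
  nlinarith [sq_nonneg (dist x y)]

theorem dist_graphMap_le {n : ℕ} (f : EuclideanSpace ℝ (Fin n) → ℝ)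
    (x y : EuclideanSpace ℝ (Fin n)) :
    dist (graphMap f x) (graphMap f y) ≤ dist x y + |f x - f y| := by
  have := dist_graphMap_sq f x y
  have h1 : 0 ≤ dist x y := dist_nonneg
  refine le_of_sq_le_sq ?_ (by positivity)
  nlinarith [mul_nonneg h1 (abs_nonneg (f x - f y))]

theorem measurable_graphMap {n : ℕ} {f : EuclideanSpace ℝ (Fin n) → ℝ} (hf : Continuous f) :
    Measurable (graphMap f) := by
  refine Continuous.measurable ?_
  refine (PiLp.continuous_toLp 2 _).comp (continuous_pi fun k => ?_)
  refine Fin.lastCases ?_ (fun i => ?_) k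
  · simpa using hf
  · simp only [Fin.snoc_castSucc]
    fun_prop

theorem continuous_weierstrass_space {n : ℕ} {ρ s : ℝ} (hρ : 1 < ρ) (hs : 0 < s)
    (θ : PhaseSpace n) : Continuous (weierstrass ρ s θ) :=
  (continuous_weierstrass (n := n) hρ hs).uncurry_left θ

/-- The close-pair measures at dyadic scales `R`, weighted by `R^(-t)`, have summable expectations.
So for almost every `θ`, and then `μ`-almost every `x`, the weighted measures of the points close to
`x` have a finite sum. Each term is at most that sum, as the mass distribution principle requires.
-/
theorem ae_le_dimH_graphOn {n : ℕ} {ρ s d β c t : ℝ} (hρ : 1 < ρ) (hs : 0 < s)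
    (hβ₀ : 0 < β) (hβ₁ : β < 1) (hβd : s * β < d) (hc : 0 < c) (ht₀ : 0 < t)
    (ht : t < d + (1 - s) * β) {μ : Measure (EuclideanSpace ℝ (Fin n))} [IsFiniteMeasure μ]
    (hμ₀ : μ ≠ 0) {K : Set (EuclideanSpace ℝ (Fin n))} (hK : μ Kᶜ = 0)
    (hμ : ∀ x ∈ K, ∀ r : ℝ, 0 < r → r ≤ 1 →
      μ (Metric.closedBall x r) ≤ ENNReal.ofReal (c * r ^ d)) :
    ∀ᵐ θ ∂(phaseMeasure n), ENNReal.ofReal t ≤ dimH (graphOn (weierstrass ρ s θ) K) := by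
  obtain ⟨C, δ, hC, hδ, hE⟩ := lintegral_measure_closePairs_le hρ hs hβ₀ hβ₁ hβd hc hK hμ
  obtain ⟨k₀, hk₀⟩ := exists_pow_lt_of_lt_one hδ (by norm_num : (1 / 2 : ℝ) < 1)
  set R : ℕ → ℝ := fun k => (1 / 2) ^ (k₀ + k) with hR
  have hR0 : ∀ k, 0 < R k := fun k => by positivity
  have hRδ : ∀ k, R k ≤ δ := fun k =>
    (pow_le_pow_of_le_one (by norm_num) (by norm_num) (Nat.le_add_right k₀ k)).trans hk₀.le
  set w : ℕ → ENNReal := fun k => ENNReal.ofReal (R k ^ (-t)) with hw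
  set e : ℝ := d + (1 - s) * β - t with he
  have he0 : 0 < e := by linarith
  have hm : ∀ k, MeasurableSet (closePairs (n := n) ρ s (R k)) :=
    fun k => measurableSet_closePairs hρ hs (R k)
  have hmeas : ∀ k, Measurable fun θ => w k * (μ.prod μ) (Prod.mk θ ⁻¹' closePairs ρ s (R k)) :=
    fun k => (measurable_measure_prodMk_left (hm k)).const_mul _
  have hfin : ∫⁻ θ, ∑' k, w k * (μ.prod μ) (Prod.mk θ ⁻¹' closePairs ρ s (R k))
      ∂(phaseMeasure n) ≠ ⊤ := by
    rw [lintegral_tsum fun k => (hmeas k).aemeasurable]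
    have hq0 : (0 : ℝ) < (1 / 2) ^ e := by positivity
    have hq1 : (1 / 2 : ℝ) ^ e < 1 := Real.rpow_lt_one (by norm_num) (by norm_num) he0
    have hsum : Summable fun k : ℕ => C * ((1 / 2 : ℝ) ^ e) ^ (k₀ + k) := by
      simp_rw [pow_add]
      exact ((summable_geometric_of_lt_one hq0.le hq1).mul_left _).mul_left _
    refine ne_top_of_le_ne_top (b := ENNReal.ofReal (∑' k : ℕ, C * ((1 / 2 : ℝ) ^ e) ^ (k₀ + k)))
      ENNReal.ofReal_ne_top ?_
    rw [ENNReal.ofReal_tsum_of_nonneg (fun k => by positivity) hsum]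
    refine ENNReal.tsum_le_tsum fun k => ?_
    rw [lintegral_const_mul' _ _ ENNReal.ofReal_ne_top]
    refine (mul_le_mul_right (hE (R k) (hR0 k) (hRδ k)) _).trans ?_
    rw [← ENNReal.ofReal_mul (Real.rpow_nonneg (hR0 k).le _)]
    refine ENNReal.ofReal_le_ofReal (le_of_eq ?_)
    have h1 : R k ^ (-t) * R k ^ (d + (1 - s) * β) = ((1 / 2 : ℝ) ^ e) ^ (k₀ + k) := by
      rw [← Real.rpow_add (hR0 k)]
      simp only [hR]
      rw [← Real.rpow_natCast, ← Real.rpow_natCast,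
        ← Real.rpow_mul (by norm_num), ← Real.rpow_mul (by norm_num), he]
      congr 1
      ring
    rw [← h1]
    ring
  filter_upwards [ae_lt_top (Measurable.tsum hmeas) hfin] with θ hθ
  have hsec : ∀ k, MeasurableSet (Prod.mk θ ⁻¹' closePairs (n := n) ρ s (R k)) :=
    fun k => measurable_prodMk_left (hm k)
  have hmeas2 : ∀ k, Measurable fun x =>
      w k * μ (Prod.mk x ⁻¹' (Prod.mk θ ⁻¹' closePairs ρ s (R k))) :=
    fun k => (measurable_measure_prodMk_left (hsec k)).const_mul _
  have hint : ∫⁻ x, ∑' k, w k * μ (Prod.mk x ⁻¹' (Prod.mk θ ⁻¹' closePairs ρ s (R k))) ∂μ ≠ ⊤ := by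
    rw [lintegral_tsum fun k => (hmeas2 k).aemeasurable]
    refine ne_of_lt (lt_of_le_of_lt (le_of_eq (tsum_congr fun k => ?_)) hθ)
    rw [lintegral_const_mul' _ _ ENNReal.ofReal_ne_top, Measure.prod_apply (hsec k)]
  rw [graphOn_eq_image]
  refine le_dimH_image_of_measure_ball_le
    (measurable_graphMap (continuous_weierstrass_space hρ hs θ)) hK hμ₀ ht₀ k₀ ?_
  filter_upwards [ae_lt_top (Measurable.tsum hmeas2) hint] with x hx
  obtain ⟨M, hM⟩ := ENNReal.exists_nat_gt hx.ne
  refine ⟨M, fun k hk => ?_⟩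
  obtain ⟨l, rfl⟩ := Nat.exists_eq_add_of_le hk
  have h1 : w l * μ {y | dist (graphMap (weierstrass ρ s θ) x) (graphMap (weierstrass ρ s θ) y) ≤
      (1 / 2) ^ (k₀ + l)} ≤ M := by
    refine le_trans (mul_le_mul_right (measure_mono fun y hy => ?_) _)
      ((ENNReal.le_tsum l).trans hM.le)
    exact ⟨(dist_le_dist_graphMap (weierstrass ρ s θ) x y).trans hy,
      (abs_sub_le_dist_graphMap (weierstrass ρ s θ) x y).trans hy⟩
  have h2 : w l * ENNReal.ofReal (R l ^ t) = 1 := by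
    rw [hw, ← ENNReal.ofReal_mul (Real.rpow_nonneg (hR0 l).le _), ← Real.rpow_add (hR0 l)]
    simp
  calc _ = (w l * ENNReal.ofReal (R l ^ t)) * μ {y | dist (graphMap (weierstrass ρ s θ) x)
        (graphMap (weierstrass ρ s θ) y) ≤ (1 / 2) ^ (k₀ + l)} := by rw [h2, one_mul]
    _ = (w l * μ {y | dist (graphMap (weierstrass ρ s θ) x)
        (graphMap (weierstrass ρ s θ) y) ≤ (1 / 2) ^ (k₀ + l)}) * ENNReal.ofReal (R l ^ t) := by
          ring
    _ ≤ _ := mul_le_mul_left h1 _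

/-! ### Covers and the upper bound -/

/-- An `r`-separated subset of `K` has disjoint balls of radius `r/2`, each of mass at least `c
(r/2)^d`, so its cardinality is bounded. One of maximal cardinality is an `r`-net of `K`. -/
theorem exists_finset_cover_of_le_measure_closedBall {X : Type*} [MetricSpace X]
    [MeasurableSpace X] [BorelSpace X] {μ : Measure X} [IsFiniteMeasure μ] {K : Set X} {d c : ℝ}
    (hc : 0 < c) (hμ : ∀ x ∈ K, ∀ r : ℝ, 0 < r → r ≤ 1 →
      ENNReal.ofReal (c * r ^ d) ≤ μ (Metric.closedBall x r)) :
    ∃ C : ℝ, 0 < C ∧ ∀ r : ℝ, 0 < r → r ≤ 1 → ∃ F : Finset X,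
      (∀ x ∈ K, ∃ y ∈ F, dist x y ≤ r) ∧ (F.card : ℝ) ≤ C * r ^ (-d) := by
  classical
  refine ⟨(μ Set.univ).toReal * (2 ^ d / c) + 1, by positivity, fun r hr hr1 => ?_⟩
  have hcard : ∀ F : Finset X, (F : Set X) ⊆ K → (F : Set X).Pairwise (fun x y => r < dist x y) →
      (F.card : ℝ) ≤ (μ Set.univ).toReal * (2 ^ d / c) * r ^ (-d) := by
    intro F hFK hF
    have hdisj : (F : Set X).PairwiseDisjoint fun x => Metric.closedBall x (r / 2) := by
      intro x hx y hy hxy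
      refine Metric.closedBall_disjoint_closedBall ?_
      have := hF hx hy hxy
      linarith
    have h1 : ∑ x ∈ F, μ (Metric.closedBall x (r / 2)) ≤ μ Set.univ := by
      rw [← measure_biUnion_finset hdisj fun x _ => Metric.isClosed_closedBall.measurableSet]
      exact measure_mono (Set.subset_univ _)
    have h2 : ENNReal.ofReal (F.card * (c * (r / 2) ^ d)) ≤
        ENNReal.ofReal (μ Set.univ).toReal := by
      rw [ENNReal.ofReal_toReal (measure_ne_top μ _)]
      refine le_trans ?_ h1
      rw [ENNReal.ofReal_mul (by positivity), ENNReal.ofReal_natCast, ← nsmul_eq_mul]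
      exact Finset.card_nsmul_le_sum _ _ _ fun x hx => hμ x (hFK hx) _ (by positivity) (by linarith)
    rw [ENNReal.ofReal_le_ofReal_iff ENNReal.toReal_nonneg, Real.div_rpow hr.le (by norm_num)] at h2
    rw [Real.rpow_neg hr.le]
    have h3 : (F.card : ℝ) = F.card * (c * (r ^ d / 2 ^ d)) * (2 ^ d / c) * (r ^ d)⁻¹ := by
      field_simp
    rw [h3]
    gcongr
  obtain ⟨N, hN⟩ := exists_nat_ge ((μ Set.univ).toReal * (2 ^ d / c) * r ^ (-d))
  let P : ℕ → Prop := fun k => ∃ F : Finset X, (F : Set X) ⊆ K ∧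
      (F : Set X).Pairwise (fun x y => r < dist x y) ∧ F.card = k
  have h₀ : P 0 := ⟨∅, by simp⟩
  have hbdd : ∀ k, P k → k ≤ N := by
    rintro k ⟨F, h1, h2, rfl⟩
    exact_mod_cast (hcard F h1 h2).trans hN
  obtain ⟨F, hFK, hF, hFk⟩ := Nat.findGreatest_spec (hbdd 0 h₀) h₀
  refine ⟨F, fun x hx => ?_, (hcard F hFK hF).trans ?_⟩
  · by_contra! hcon
    have hxF : x ∉ F := fun h => by
      have := hcon x h
      rw [dist_self] at this
      linarith
    have hP : P (F.card + 1) := by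
      refine ⟨insert x F, ?_, ?_, Finset.card_insert_of_notMem hxF⟩
      · rw [Finset.coe_insert]
        exact Set.insert_subset hx hFK
      · rw [Finset.coe_insert]
        refine hF.insert_of_notMem (by simpa using hxF) fun y hy => ⟨hcon y hy, ?_⟩
        rw [dist_comm]
        exact hcon y hy
    have := Nat.le_findGreatest (hbdd _ hP) hP
    omega
  · have : 0 < r ^ (-d) := by positivity
    nlinarith

open scoped ENNReal in
/-- The Hausdorff dimension is bounded by the exponent of efficient covers at dyadic scales. -/
theorem dimH_le_of_finset_covers {X : Type*} [MetricSpace X] [MeasurableSpace X] [BorelSpace X]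
    {A : Set X} {t C : ℝ} (ht : 0 ≤ t) (hC : 0 ≤ C)
    (h : ∀ k : ℕ, ∃ F : Finset (Set X), A ⊆ ⋃₀ F ∧ (F.card : ℝ) ≤ C * ((1 / 2) ^ k) ^ (-t) ∧
      ∀ U ∈ F, Metric.ediam U ≤ ENNReal.ofReal (C * (1 / 2) ^ k)) :
    dimH A ≤ ENNReal.ofReal t := by
  choose F hA hF hdiam using h
  have hr : Filter.Tendsto (fun k : ℕ => ENNReal.ofReal (C * (1 / 2) ^ k)) Filter.atTop (nhds 0) := by
    have := (tendsto_pow_atTop_nhds_zero_of_lt_one (r := (1 / 2 : ℝ)) (by norm_num)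
      (by norm_num)).const_mul C
    rw [mul_zero] at this
    simpa using ENNReal.tendsto_ofReal this
  have hle := Measure.hausdorffMeasure_le_liminf_sum (ι := fun k => F k) t A _ hr
    (fun k U => (U : Set X)) (Filter.Eventually.of_forall fun k U => hdiam k U U.2)
    (Filter.Eventually.of_forall fun k => by
      intro x hx
      obtain ⟨U, hU, hxU⟩ := hA k hx
      exact Set.mem_iUnion.2 ⟨⟨U, hU⟩, hxU⟩)
  have hbound : ∀ k, ∑ U : F k, Metric.ediam (U : Set X) ^ t ≤ ENNReal.ofReal (C * C ^ t) := by
    intro k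
    calc ∑ U : F k, Metric.ediam (U : Set X) ^ t
        ≤ ∑ _U : F k, ENNReal.ofReal (C * (1 / 2) ^ k) ^ t :=
          Finset.sum_le_sum fun U _ => ENNReal.rpow_le_rpow (hdiam k U U.2) ht
      _ = ENNReal.ofReal ((F k).card * (C * (1 / 2) ^ k) ^ t) := by
          rw [Finset.sum_const, nsmul_eq_mul, Finset.card_univ, Fintype.card_coe,
            ENNReal.ofReal_rpow_of_nonneg (by positivity) ht, ENNReal.ofReal_mul (by positivity),
            ENNReal.ofReal_natCast]
      _ ≤ _ := by
          refine ENNReal.ofReal_le_ofReal ?_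
          have h0 : (0 : ℝ) < (1 / 2) ^ k := by positivity
          calc ((F k).card : ℝ) * (C * (1 / 2) ^ k) ^ t
              ≤ C * ((1 / 2) ^ k) ^ (-t) * (C * (1 / 2) ^ k) ^ t := by
                gcongr
                exact hF k
            _ = C * C ^ t := by
                rw [Real.mul_rpow hC h0.le, Real.rpow_neg h0.le]
                field_simp
  have htop : Measure.hausdorffMeasure t A ≠ ⊤ := by
    refine ne_top_of_le_ne_top (b := ENNReal.ofReal (C * C ^ t)) ENNReal.ofReal_ne_top (hle.trans
      ((Filter.liminf_le_liminf (Filter.Eventually.of_forall hbound)).trans ?_))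
    rw [Filter.liminf_const]
  have hcoe : ((t.toNNReal : NNReal) : ℝ) = t := Real.coe_toNNReal t ht
  exact dimH_le_of_hausdorffMeasure_ne_top (by rwa [hcoe])

/-- Over a ball of radius `q = r^(1/t) ≤ r` the function varies by at most `2 L r`, so the graph
piece has diameter of order `r`; about `q^(-d) = r^(-d/t)` pieces suffice. -/
theorem dimH_graphOn_le_div {n : ℕ} {f : EuclideanSpace ℝ (Fin n) → ℝ}
    {K : Set (EuclideanSpace ℝ (Fin n))} {d t C L : ℝ} (hd : 0 ≤ d) (ht₀ : 0 < t) (ht₁ : t ≤ 1)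
    (hC : 0 < C) (hL : 0 < L) (hf : ∀ x y, |f x - f y| ≤ L * dist x y ^ t)
    (hK : ∀ r : ℝ, 0 < r → r ≤ 1 → ∃ F : Finset (EuclideanSpace ℝ (Fin n)),
      (∀ x ∈ K, ∃ y ∈ F, dist x y ≤ r) ∧ (F.card : ℝ) ≤ C * r ^ (-d)) :
    dimH (graphOn f K) ≤ ENNReal.ofReal (d / t) := by
  classical
  rw [graphOn_eq_image]
  refine dimH_le_of_finset_covers (C := C + 2 + 2 * L) (by positivity) (by positivity) fun k => ?_
  set r : ℝ := (1 / 2) ^ k with hr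
  have hr0 : 0 < r := by positivity
  have hr1 : r ≤ 1 := pow_le_one₀ (by norm_num) (by norm_num)
  set q : ℝ := r ^ (1 / t) with hq
  have hq0 : 0 < q := by positivity
  have hqr : q ≤ r := by
    have := Real.rpow_le_rpow_of_exponent_ge hr0 hr1 ((one_le_div ht₀).2 ht₁)
    rwa [Real.rpow_one] at this
  have hqt : q ^ t = r := by
    rw [hq, ← Real.rpow_mul hr0.le, one_div_mul_cancel ht₀.ne', Real.rpow_one]
  obtain ⟨F, hF, hcard⟩ := hK q hq0 (hqr.trans hr1)
  refine ⟨F.image fun y => graphMap f '' Metric.closedBall y q, ?_, ?_, ?_⟩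
  · rintro _ ⟨x, hx, rfl⟩
    obtain ⟨y, hy, hxy⟩ := hF x hx
    exact Set.mem_sUnion.2 ⟨_, Finset.mem_coe.2 (Finset.mem_image_of_mem _ hy), x, hxy, rfl⟩
  · calc ((F.image fun y => graphMap f '' Metric.closedBall y q).card : ℝ) ≤ F.card := by
          exact_mod_cast Finset.card_image_le
      _ ≤ C * q ^ (-d) := hcard
      _ = C * r ^ (-(d / t)) := by
          rw [hq, ← Real.rpow_mul hr0.le]
          congr 2
          ring
      _ ≤ _ := by
          gcongr
          linarith
  · intro U hU
    obtain ⟨y, -, rfl⟩ := Finset.mem_image.1 hU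
    refine Metric.ediam_le ?_
    rintro _ ⟨x, hx, rfl⟩ _ ⟨x', hx', rfl⟩
    rw [edist_dist]
    refine ENNReal.ofReal_le_ofReal ((dist_graphMap_le f x x').trans ?_)
    rw [Metric.mem_closedBall] at hx hx'
    have h1 : dist x x' ≤ 2 * q := by linarith [dist_triangle_right x x' y]
    have h2 : ∀ z, dist z y ≤ q → |f z - f y| ≤ L * r := fun z hz => by
      refine (hf z y).trans ?_
      rw [← hqt]
      gcongr
    have h3 : |f x - f x'| ≤ |f x - f y| + |f x' - f y| := by
      simpa [Real.dist_eq] using dist_triangle_right (f x) (f x') (f y)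
    have h4 := h2 x hx
    have h5 := h2 x' hx'
    nlinarith

/-- Over a ball of radius `r` the graph has height at most `2 L r^t`, so it splits into about
`r^(t-1)` layers of height `r`. -/
theorem dimH_graphOn_le_add {n : ℕ} {f : EuclideanSpace ℝ (Fin n) → ℝ}
    {K : Set (EuclideanSpace ℝ (Fin n))} {d t C L : ℝ} (hd : 0 ≤ d) (ht₀ : 0 < t) (ht₁ : t ≤ 1)
    (hC : 0 < C) (hL : 0 < L) (hf : ∀ x y, |f x - f y| ≤ L * dist x y ^ t)
    (hK : ∀ r : ℝ, 0 < r → r ≤ 1 → ∃ F : Finset (EuclideanSpace ℝ (Fin n)),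
      (∀ x ∈ K, ∃ y ∈ F, dist x y ≤ r) ∧ (F.card : ℝ) ≤ C * r ^ (-d)) :
    dimH (graphOn f K) ≤ ENNReal.ofReal (d + 1 - t) := by
  classical
  rw [graphOn_eq_image]
  refine dimH_le_of_finset_covers (C := C * (2 * L + 1) + 3) (by linarith) (by positivity)
    fun k => ?_
  set r : ℝ := (1 / 2) ^ k with hr
  have hr0 : 0 < r := by positivity
  have hr1 : r ≤ 1 := pow_le_one₀ (by norm_num) (by norm_num)
  obtain ⟨F, hF, hcard⟩ := hK r hr0 hr1
  -- The shift by `L * r ^ t` makes the height above the ball nonnegative, so that layers are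
  -- indexed by natural numbers.
  set V : EuclideanSpace ℝ (Fin n) × ℕ → Set (EuclideanSpace ℝ (Fin n)) := fun p =>
    {x | dist x p.1 ≤ r ∧ p.2 * r ≤ f x - f p.1 + L * r ^ t ∧
      f x - f p.1 + L * r ^ t ≤ (p.2 + 1) * r} with hV
  set M : ℕ := ⌊2 * L * r ^ (t - 1)⌋₊ + 1 with hM
  have hrt : r ^ t = r ^ (t - 1) * r := by
    rw [← Real.rpow_add_one hr0.ne']
    congr 1
    ring
  refine ⟨(F ×ˢ Finset.range M).image fun p => graphMap f '' V p, ?_, ?_, ?_⟩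
  · rintro _ ⟨x, hx, rfl⟩
    obtain ⟨y, hy, hxy⟩ := hF x hx
    have habs : |f x - f y| ≤ L * r ^ t := (hf x y).trans (by gcongr)
    rw [abs_le] at habs
    have h0 : 0 ≤ (f x - f y + L * r ^ t) / r := div_nonneg (by linarith) hr0.le
    set m := ⌊(f x - f y + L * r ^ t) / r⌋₊ with hm
    have hmM : m < M := by
      rw [hM, Nat.lt_succ_iff]
      refine Nat.floor_le_floor ?_
      rw [div_le_iff₀ hr0, mul_assoc, ← hrt]
      linarith
    have hxV : x ∈ V (y, m) := by
      refine ⟨hxy, ?_, ?_⟩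
      · exact (le_div_iff₀ hr0).1 (Nat.floor_le h0)
      · exact (div_le_iff₀ hr0).1 (Nat.lt_floor_add_one _).le
    exact Set.mem_sUnion.2 ⟨graphMap f '' V (y, m), Finset.mem_coe.2 (Finset.mem_image.2
      ⟨(y, m), Finset.mem_product.2 ⟨hy, Finset.mem_range.2 hmM⟩, rfl⟩),
      Set.mem_image_of_mem _ hxV⟩
  · have hMle : (M : ℝ) ≤ (2 * L + 1) * r ^ (t - 1) := by
      have h1 : (⌊2 * L * r ^ (t - 1)⌋₊ : ℝ) ≤ 2 * L * r ^ (t - 1) := Nat.floor_le (by positivity)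
      have h2 : 1 ≤ r ^ (t - 1) := Real.one_le_rpow_of_pos_of_le_one_of_nonpos hr0 hr1 (by linarith)
      rw [hM]
      push_cast
      linarith
    calc (((F ×ˢ Finset.range M).image fun p => graphMap f '' V p).card : ℝ)
        ≤ (F ×ˢ Finset.range M).card := Nat.cast_le.2 Finset.card_image_le
      _ = F.card * M := by rw [Finset.card_product, Finset.card_range, Nat.cast_mul]
      _ ≤ C * r ^ (-d) * ((2 * L + 1) * r ^ (t - 1)) := by gcongr
      _ = C * (2 * L + 1) * r ^ (-(d + 1 - t)) := by
          have : r ^ (-(d + 1 - t)) = r ^ (-d) * r ^ (t - 1) := by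
            rw [← Real.rpow_add hr0]
            congr 1
            ring
          rw [this]
          ring
      _ ≤ _ := by
          gcongr
          linarith
  · intro U hU
    obtain ⟨⟨y, m⟩, -, rfl⟩ := Finset.mem_image.1 hU
    refine Metric.ediam_le ?_
    rintro _ ⟨x, ⟨hx1, hx2, hx3⟩, rfl⟩ _ ⟨x', ⟨hx1', hx2', hx3'⟩, rfl⟩
    rw [edist_dist]
    refine ENNReal.ofReal_le_ofReal ((dist_graphMap_le f x x').trans ?_)
    have h1 : dist x x' ≤ 2 * r := by linarith [dist_triangle_right x x' y]
    have h2 : |f x - f x'| ≤ r := by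
      rw [abs_le]
      constructor <;> linarith
    have h3 : 0 ≤ C * (2 * L + 1) * r := by positivity
    linarith

theorem dimH_graphOn_weierstrass_le {n : ℕ} {ρ s d c : ℝ} (hρ : 1 < ρ) (hs₀ : 0 < s) (hs₁ : s < 1)
    (hd : 0 < d) (hc : 0 < c) {μ : Measure (EuclideanSpace ℝ (Fin n))} [IsFiniteMeasure μ]
    {K : Set (EuclideanSpace ℝ (Fin n))} (hμ : ∀ x ∈ K, ∀ r : ℝ, 0 < r → r ≤ 1 →
      ENNReal.ofReal (c * r ^ d) ≤ μ (Metric.closedBall x r)) (θ : PhaseSpace n) :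
    dimH (graphOn (weierstrass ρ s θ) K) ≤ ENNReal.ofReal (dimExponent d s) := by
  obtain ⟨C, hC, hK⟩ := exists_finset_cover_of_le_measure_closedBall hc hμ
  have hev : ∀ᶠ t in nhdsWithin s (Set.Iio s), 0 < t ∧ t < s := by
    filter_upwards [Ioo_mem_nhdsLT hs₀] with t ht using ht
  unfold dimExponent
  split_ifs
  · have hlim : Filter.Tendsto (fun t => ENNReal.ofReal (d + 1 - t)) (nhdsWithin s (Set.Iio s))
        (nhds (ENNReal.ofReal (d + 1 - s))) :=
      (ENNReal.tendsto_ofReal ((continuous_const.sub continuous_id).tendsto s)).mono_left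
        nhdsWithin_le_nhds
    refine ge_of_tendsto hlim ?_
    filter_upwards [hev] with t ht
    obtain ⟨L, hL, hf⟩ := weierstrass_sub_le (n := n) hρ ht.1 ht.2 (ht.2.trans hs₁).le
    exact dimH_graphOn_le_add hd.le ht.1 (ht.2.trans hs₁).le hC hL (hf θ) hK
  · have hlim : Filter.Tendsto (fun t => ENNReal.ofReal (d / t)) (nhdsWithin s (Set.Iio s))
        (nhds (ENNReal.ofReal (d / s))) :=
      (ENNReal.tendsto_ofReal (tendsto_const_nhds.div Filter.tendsto_id hs₀.ne')).mono_left
        nhdsWithin_le_nhds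
    refine ge_of_tendsto hlim ?_
    filter_upwards [hev] with t ht
    obtain ⟨L, hL, hf⟩ := weierstrass_sub_le (n := n) hρ ht.1 ht.2 (ht.2.trans hs₁).le
    exact dimH_graphOn_le_div hd.le ht.1 (ht.2.trans hs₁).le hC hL (hf θ) hK

/-! ### Choice of the exponent and conclusion -/

/-- As `β` increases to `min(1, d/s)`, `d + (1-s)β` increases to `d + 1 - s` if `s < d`, and to `d +
(1-s)d/s = d/s` otherwise. -/
theorem exists_exponent_of_lt_dimExponent {s d t : ℝ} (hs₀ : 0 < s) (hs₁ : s < 1) (hd : 0 < d)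
    (ht : t < dimExponent d s) :
    ∃ β, 0 < β ∧ β < 1 ∧ s * β < d ∧ t < d + (1 - s) * β := by
  have hs : 0 < 1 - s := by linarith
  have hβ : max 0 ((t - d) / (1 - s)) < min 1 (d / s) := by
    rw [max_lt_iff, lt_min_iff, lt_min_iff, div_lt_iff₀ hs, div_lt_iff₀ hs]
    refine ⟨⟨one_pos, by positivity⟩, ?_⟩
    unfold dimExponent at ht
    have hds : d / s * s = d := div_mul_cancel₀ d hs₀.ne'
    split_ifs at ht with h
    · have : 1 < d / s := (one_lt_div hs₀).2 h
      constructor <;> nlinarith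
    · have : d / s ≤ 1 := (div_le_one hs₀).2 (not_lt.1 h)
      constructor <;> nlinarith
  obtain ⟨β, h1, h2⟩ := exists_between hβ
  rw [max_lt_iff, div_lt_iff₀ hs] at h1
  rw [lt_min_iff, lt_div_iff₀ hs₀] at h2
  exact ⟨β, h1.1, h2.1, by linarith, by linarith⟩

/-- For almost every choice of phases, the graph over a `d`-set has dimension `H(d, s)`. -/
theorem ae_dimH_graphOn_weierstrass {n : ℕ} {ρ s d : ℝ} (hρ : 1 < ρ) (hs₀ : 0 < s) (hs₁ : s < 1)
    (hd₀ : 0 < d) {K : Set (EuclideanSpace ℝ (Fin n))} (hK : IsDSet d K) :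
    ∀ᵐ θ ∂(phaseMeasure n),
      dimH (graphOn (weierstrass ρ s θ) K) = ENNReal.ofReal (dimExponent d s) := by
  obtain ⟨-, μ, hμ0, hμtop, hsupp, c₁, c₂, hc₁, hc₂, hball⟩ := hK
  have : IsFiniteMeasure μ := ⟨hμtop⟩
  have hKc : μ Kᶜ = 0 := by
    rw [← hsupp]
    exact Measure.measure_compl_support
  have hne : μ ≠ 0 := by
    rintro rfl
    simp at hμ0
  -- Countably many exponents increasing to `H(d, s)`, so that the exceptional null sets can be
  -- united; nonpositive exponents are trivial.
  have hlow : ∀ᵐ θ ∂(phaseMeasure n), ∀ k : ℕ,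
      ENNReal.ofReal (dimExponent d s - 1 / (k + 1)) ≤
        dimH (graphOn (weierstrass ρ s θ) K) := by
    rw [ae_all_iff]
    intro k
    rcases le_or_gt (dimExponent d s - 1 / (k + 1)) 0 with h | h
    · rw [ENNReal.ofReal_of_nonpos h]
      exact Filter.Eventually.of_forall fun θ => zero_le
    · obtain ⟨β, hβ₀, hβ₁, hβd, ht⟩ := exists_exponent_of_lt_dimExponent (t :=
        dimExponent d s - 1 / (k + 1)) hs₀ hs₁ hd₀ (sub_lt_self _ (by positivity))
      exact ae_le_dimH_graphOn hρ hs₀ hβ₀ hβ₁ hβd hc₂ h ht hne hKc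
        fun x hx r hr hr1 => (hball r hr hr1 x hx).2
  filter_upwards [hlow] with θ hθ
  refine le_antisymm (dimH_graphOn_weierstrass_le hρ hs₀ hs₁ hd₀ hc₁
    (fun x hx r hr hr1 => (hball r hr hr1 x hx).1) θ) ?_
  have hlim : Filter.Tendsto (fun k : ℕ => ENNReal.ofReal (dimExponent d s - 1 / ((k : ℝ) + 1)))
      Filter.atTop (nhds (ENNReal.ofReal (dimExponent d s))) := by
    have := (tendsto_const_nhds (x := dimExponent d s)).sub tendsto_one_div_add_atTop_nhds_zero_nat
    rw [sub_zero] at this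
    exact ENNReal.tendsto_ofReal this
  exact le_of_tendsto' hlim hθ

end WeierstrassGraph

theorem mainTheorem2 (n : ℕ) (ρ s d : ℝ) (hρ : 1 < ρ) (hs₀ : 0 < s) (hs₁ : s < 1)
    (hd₀ : 0 < d) (hdn : d ≤ n) (K : Set (EuclideanSpace ℝ (Fin n)))
    (hK : WeierstrassGraph.IsDSet d K) :
    ∀ᵐ θ ∂(WeierstrassGraph.phaseMeasure n),
      dimH (WeierstrassGraph.graphOn (WeierstrassGraph.weierstrass ρ s θ) K) =
        ENNReal.ofReal (WeierstrassGraph.dimExponent d s) := by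
  exact WeierstrassGraph.ae_dimH_graphOn_weierstrass hρ hs₀ hs₁ hd₀ hK
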